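/- Work on $\mathbb{R}^{1,3}$ with coordinates $x^0,\dots,x^3$, metric $\eta=\mathrm{diag}(-1,1,1,1)$, $\nabla_\mu=\partial/\partial x^\mu$, and the totally antisymmetric tensor with $\epsilon_{0123}=1$; indices are moved with $\eta$ and repeated indices are summed. Let $\Omega\subset\mathbb{R}^{1,3}$ be open, let $A_\mu$ be a smooth gauge potential on $\Omega$, and let $F_{\mu\nu}=\nabla_\mu A_\nu-\nabla_\nu A_\mu$. Put $W=\int\tfrac14F_{\mu\nu}F^{\mu\nu}\,d^4x$ and, for a smooth function $f$, $\tilde H(f)=\int\tfrac14\epsilon^{\mu\nu\alpha\beta}fF_{\mu\nu}F_{\alpha\beta}\,d^4x$. Variations of $A$ are smooth one-parameter families $A^{(s)}$, $s\in\mathbb{R}$, with $A^{(0)}=A$, that agree with $A$ outside a compact subset $K$ of the region under consideration (so $\delta A=0$ on the boundary); a functional is stationary at $A$ along such a family if the $s$-derivative at $s=0$ of its integral over $K$ is $0$. (1) Suppose that $A$ is an extremal of $W$ on $\Omega$ subject to the local constraint $\epsilon^{\mu\nu\alpha\beta}F_{\mu\nu}F_{\alpha\beta}=0$ (i.e. $E\cdot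 B=0$): $A$ satisfies the constraint on $\Omega$, and $W$ is stationary at $A$ along every variation in $\Omega$ all of whose members satisfy the constraint on $\Omega$. Then every point $x\in\Omega$ such that $F(x)\neq0$, or such that $F$ vanishes identically near $x$, has an open neighbourhood $U\subset\Omega$ with a smooth function $f:U\to\mathbb{R}$ (a Lagrange multiplier) such that $A$ is an extremal, without constraint, of $W-\tfrac12\tilde H(f)$ on $U$, and the covariant Beltrami equation $$\nabla^\nu F_{\mu\nu}=\tfrac12\,\epsilon_{\mu\nu\alpha\beta}\lambda^\nu F^{\alpha\beta},\qquad \lambda_\mu=\nabla_\mu f,$$ holds on $U$. (2) If $f:\Omega\to\mathbb{R}$ is any smooth function on the whole of $\Omega$ and $A$ satisfies the constraint on $\Omega$ and is an extremal of $W-\tfrac12\tilde H(f)$ on $\Omega$ (that is, $f$ is a Lagrange multiplier on all of $\Omega$), then the covariant Beltrami equation with $\lambda_\mu=\nabla_\mu f$ holds on all of $\Omega$. -/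

import Mathlib

open Set MeasureTheory
open scoped ContDiff Topology

noncomputable section

namespace Beltrami

/-- Coordinates `x = (x⁰, x¹, x², x³)` on Minkowski space `ℝ^{1,3}`. -/
abbrev Spacetime : Type := Fin 4 → ℝ

/-- The diagonal entries of the (constant, diagonal) metric `η = diag (-1, 1, 1, 1)`, which is
its own inverse: raising or lowering the index `μ` multiplies the component by `eta μ`. -/
def eta : Fin 4 → ℝ := ![-1, 1, 1, 1]

/-- The Levi-Civita tensor `ε_{μναβ}`, totally antisymmetric with `ε_{0123} = 1`
(the determinant of the matrix whose rows are the unit vectors `e_μ, e_ν, e_α, e_β`). -/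
def eps (μ ν α β : Fin 4) : ℝ :=
  (Matrix.of fun i j : Fin 4 => if ![μ, ν, α, β] i = j then (1 : ℝ) else 0).det

/-- The Levi-Civita tensor with all indices raised, `ε^{μναβ}`. -/
def epsUp (μ ν α β : Fin 4) : ℝ := eta μ * eta ν * eta α * eta β * eps μ ν α β

/-- The partial derivative `∇_μ g = ∂g/∂x^μ` of a scalar function. -/
def pd (μ : Fin 4) (g : Spacetime → ℝ) (x : Spacetime) : ℝ :=
  fderiv ℝ g x (Pi.single μ 1)

/-- The field strength `F_{μν} = ∇_μ A_ν - ∇_ν A_μ` of the gauge potential `A` (with lower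
components `A x μ`). -/
def F (A : Spacetime → Fin 4 → ℝ) (μ ν : Fin 4) (x : Spacetime) : ℝ :=
  pd μ (fun y => A y ν) x - pd ν (fun y => A y μ) x

/-- The field strength with raised indices, `F^{μν}`. -/
def FUp (A : Spacetime → Fin 4 → ℝ) (μ ν : Fin 4) (x : Spacetime) : ℝ :=
  eta μ * eta ν * F A μ ν x

/-- The scalar `ε^{μναβ} F_{μν} F_{αβ}` (a nonzero multiple of `E · B`). -/
def epsFF (A : Spacetime → Fin 4 → ℝ) (x : Spacetime) : ℝ :=
  ∑ μ, ∑ ν, ∑ α, ∑ β, epsUp μ ν α β * F A μ ν x * F A α β x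

/-- `W = ∫_K ¼ F_{μν} F^{μν} d⁴x`. -/
def W (K : Set Spacetime) (A : Spacetime → Fin 4 → ℝ) : ℝ :=
  ∫ x in K, (1 / 4) * ∑ μ, ∑ ν, F A μ ν x * FUp A μ ν x

/-- `H̃(f) = ∫_K ¼ ε^{μναβ} f F_{μν} F_{αβ} d⁴x`. -/
def Htilde (K : Set Spacetime) (f : Spacetime → ℝ) (A : Spacetime → Fin 4 → ℝ) : ℝ :=
  ∫ x in K, (1 / 4) * (f x * epsFF A x)

/-- `a` is a smooth one-parameter family of potentials on `Ω` with `a 0 = A`, all of whose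
members agree with `A` off the set `K`. (For compact `K ⊆ Ω` they agree with `A` near `∂Ω`.) -/
structure IsVariation (Ω K : Set Spacetime) (A : Spacetime → Fin 4 → ℝ)
    (a : ℝ → Spacetime → Fin 4 → ℝ) : Prop where
  smooth : ContDiffOn ℝ ∞ (fun p : ℝ × Spacetime => a p.1 p.2) (univ ×ˢ Ω)
  start : ∀ x ∈ Ω, a 0 x = A x
  fixed : ∀ s, ∀ x ∈ Ω \ K, a s x = A x

/-- `A` is an extremal of `W` on `Ω` subject to the local constraint `ε^{μναβ} F_{μν} F_{αβ} = 0`: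
it satisfies the constraint, and `W` is stationary at `A` along every smooth family of potentials
that all satisfy the constraint and differ from `A` only in a compact set `K ⊆ Ω`. Such a family
does not change the Lagrangian off `K`, so only the (always finite) part `W K` of the action
enters, and no integrability over all of `Ω` is needed. -/
structure IsConstrainedExtremal (Ω : Set Spacetime) (A : Spacetime → Fin 4 → ℝ) : Prop where
  constraint : ∀ x ∈ Ω, epsFF A x = 0
  stationary : ∀ K ⊆ Ω, IsCompact K → ∀ a, IsVariation Ω K A a →
    (∀ s, ∀ x ∈ Ω, epsFF (a s) x = 0) → HasDerivAt (fun s => W K (a s)) 0 0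

/-- `A` is an (unconstrained) extremal on `Ω` of `W - ½ H̃(f)`, the functional with
multiplier function `f`. -/
def IsMultiplierExtremal (Ω : Set Spacetime) (f : Spacetime → ℝ)
    (A : Spacetime → Fin 4 → ℝ) : Prop :=
  ∀ K ⊆ Ω, IsCompact K → ∀ a, IsVariation Ω K A a →
    HasDerivAt (fun s => W K (a s) - (1 / 2) * Htilde K f (a s)) 0 0

/-- The covariant Beltrami equation `∇^ν F_{μν} = ½ ε_{μναβ} λ^ν F^{αβ}` on `U`, for the
covector field with lower components `lam ν x = λ_ν`. -/
def BeltramiEquation (U : Set Spacetime) (A : Spacetime → Fin 4 → ℝ)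
    (lam : Fin 4 → Spacetime → ℝ) : Prop :=
  ∀ x ∈ U, ∀ μ,
    ∑ ν, eta ν * pd ν (F A μ ν) x =
      (1 / 2) * ∑ ν, ∑ α, ∑ β, eps μ ν α β * (eta ν * lam ν x) * FUp A α β x

end Beltrami

end

/-! Write J^μ = ∇_ν F^{μν} and *F for the dual field. The first variation of W - ½ H̃(f) is ∫ R^μ
δA_μ with R^μ = J^μ - *F^{μν} ∇_ν f: since *F is divergence free, integration by parts leaves only
the gradient of f (`hasDerivAt_action`). The fundamental lemma then gives R = 0, the Beltrami
equation with a raised index, which is (2). Conversely R = 0 makes A extremal, so (1) reduces to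
solving *F ∇f = J locally.

The constraint says F ∧ F = 0, which survives pullback of A along x ↦ x + t χ(x) e_κ. These
pullbacks are the only constrained variations needed. Their infinitesimal variation is a Lie
derivative, whose exact part is invisible because J is conserved; what remains is F_{κμ} J^μ = 0
(`IsConstrainedExtremal.sum_current_mul_F`).

Where F ≠ 0, the vanishing Pfaffian forces rank 2, so ker F is a plane field; it contains J and is
the image of *F. If F_{ab} ≠ 0 and c, d are the other indices, ker F is spanned by fields X_c, X_d
equal to e_c, e_d up to combinations of e_a, e_b, and closedness of F makes them commute. Components
c and d of *F ∇f = J read s F_{ab} X_d f = J^c and -s F_{ab} X_c f = J^d with a sign s. The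
compatibility condition of this system is conservation of J, modulo F J = 0 and dF = 0
(`IsComplement.fderiv_current_compat`). Components a and b follow from F R = 0. Near points where F
vanishes identically, f = 0 works.

The commuting system is solved by characteristics (`exists_smooth_fderiv_eq_of_commute`). This uses
flows that depend smoothly on time and initial point; they come from the implicit function theorem
in a Banach space of continuous paths (`exists_smooth_localFlow`). -/

/-! ### Smoothness of composition operators on spaces of continuous paths -/

namespace ContinuousMap

universe u v

variable {I : Type*} [TopologicalSpace I] [CompactSpace I]

/-- Pointwise application of a continuous family of continuous linear maps, as a continuous
bilinear map. -/
noncomputable def applyL (I : Type*) [TopologicalSpace I] [CompactSpace I]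
    (E : Type*) [NormedAddCommGroup E] [NormedSpace ℝ E]
    (G : Type*) [NormedAddCommGroup G] [NormedSpace ℝ G] :
    C(I, E →L[ℝ] G) →L[ℝ] C(I, E) →L[ℝ] C(I, G) :=
  LinearMap.mkContinuous₂
    (LinearMap.mk₂ ℝ (fun (T : C(I, E →L[ℝ] G)) (z : C(I, E)) =>
        (⟨fun s => T s (z s), T.continuous.clm_apply z.continuous⟩ : C(I, G)))
      (fun _ _ _ => by ext; simp) (fun _ _ _ => by ext; simp)
      (fun _ _ _ => by ext; simp) (fun _ _ _ => by ext; simp)) 1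
    (fun T z => by
      rw [ContinuousMap.norm_le _ (by positivity)]
      intro s
      simp only [LinearMap.mk₂_apply, ContinuousMap.coe_mk, one_mul]
      exact (T s).le_of_opNorm_le_of_le (T.norm_coe_le_norm s) (z.norm_coe_le_norm s))

@[simp] lemma applyL_apply {E : Type*} [NormedAddCommGroup E] [NormedSpace ℝ E]
    {G : Type*} [NormedAddCommGroup G] [NormedSpace ℝ G]
    (T : C(I, E →L[ℝ] G)) (z : C(I, E)) (s : I) : applyL I E G T z s = T s (z s) := rfl

/-- The mean value inequality is applied at each parameter separately. Its constant is uniform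
because postcomposition with g' is continuous in the sup norm. -/
lemma hasFDerivAt_comp_left {E : Type*} [NormedAddCommGroup E] [NormedSpace ℝ E]
    {G : Type*} [NormedAddCommGroup G] [NormedSpace ℝ G]
    (g : C(E, G)) (g' : C(E, E →L[ℝ] G)) (h : ∀ x, HasFDerivAt g (g' x) x) (y : C(I, E)) :
    HasFDerivAt (fun y : C(I, E) => g.comp y) (applyL I E G (g'.comp y)) y := by
  rw [hasFDerivAt_iff_isLittleO, Asymptotics.isLittleO_iff]
  intro c hc
  have hcont : ContinuousAt (fun y : C(I, E) => g'.comp y) y :=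
    (ContinuousMap.continuous_postcomp g').continuousAt
  obtain ⟨δ, hδ, hball⟩ := Metric.continuousAt_iff (α := C(I, E)) (β := C(I, E →L[ℝ] G)) |>.1 hcont c hc
  filter_upwards [Metric.ball_mem_nhds y hδ] with z hz
  rw [ContinuousMap.norm_le _ (by positivity)]
  intro s
  have hseg : ∀ w ∈ segment ℝ (y s) (z s), ‖g' w - g' (y s)‖ ≤ c := by
    -- A point of the segment is the value at s of the path a • y + b • z, which stays in the convex
    -- ball around y.
    rintro w ⟨a, b, ha, hb, hab, rfl⟩
    have hmem : a • y + b • z ∈ Metric.ball y δ :=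
      (convex_ball y δ) (Metric.mem_ball_self hδ) hz ha hb hab
    have := (ContinuousMap.dist_lt_iff hc).1 (hball hmem) s
    rw [dist_eq_norm] at this
    exact this.le
  have := (convex_segment (y s) (z s)).norm_image_sub_le_of_norm_hasFDerivWithin_le'
    (fun w _ => (h w).hasFDerivWithinAt) hseg (left_mem_segment ℝ _ _) (right_mem_segment ℝ _ _)
  refine le_trans (le_of_eq ?_) (this.trans ?_)
  · simp
  · gcongr
    exact (z - y).norm_coe_le_norm s

/-- The derivative is postcomposition with `fderiv ℝ g` followed by the bounded linear `applyL`, so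
the induction moves to the codomain E →L[ℝ] G. Hence G is generalized and shares the universe of E.
-/
lemma contDiff_comp_left_nat (n : ℕ) {E : Type u} [NormedAddCommGroup E] [NormedSpace ℝ E]
    {G : Type u} [NormedAddCommGroup G] [NormedSpace ℝ G]
    (g : C(E, G)) (hg : ContDiff ℝ n g) :
    ContDiff ℝ n (fun y : C(I, E) => g.comp y) := by
  induction n generalizing G with
  | zero =>
    simpa using ContinuousMap.continuous_postcomp g
  | succ n ih =>
    have hg' : ContDiff ℝ n (fderiv ℝ g) := hg.fderiv_right (by norm_cast)
    have hd : Differentiable ℝ g := hg.differentiable (by norm_cast)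
    push_cast
    rw [contDiff_succ_iff_hasFDerivAt]
    let g' : C(E, E →L[ℝ] G) := ⟨fderiv ℝ g, hg'.continuous⟩
    refine ⟨fun y => applyL I E G (g'.comp y), ?_, fun y =>
      hasFDerivAt_comp_left g g' (fun x => (hd x).hasFDerivAt) y⟩
    exact (applyL I E G).contDiff.comp (ih g' hg')

/-- Composition with a smooth map is a smooth operator on continuous paths. -/
lemma contDiff_comp_left {E : Type u} [NormedAddCommGroup E] [NormedSpace ℝ E]
    {G : Type u} [NormedAddCommGroup G] [NormedSpace ℝ G]
    (g : C(E, G)) (hg : ContDiff ℝ ∞ g) :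
    ContDiff ℝ ∞ (fun y : C(I, E) => g.comp y) :=
  contDiff_infty.2 fun n => contDiff_comp_left_nat n g (contDiff_infty.1 hg n)

end ContinuousMap

/-! ### Smooth local flows -/

section Flow

/-- The implicit function theorem with `C^∞` regularity of the implicit function on a whole
neighbourhood of the base point. -/
lemma ContDiff.exists_smooth_implicitFunction {E₁ E₂ G : Type*}
    [NormedAddCommGroup E₁] [NormedSpace ℝ E₁] [CompleteSpace E₁]
    [NormedAddCommGroup E₂] [NormedSpace ℝ E₂] [CompleteSpace E₂]
    [NormedAddCommGroup G] [NormedSpace ℝ G] [CompleteSpace G]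
    {f : E₁ × E₂ → G} (hf : ContDiff ℝ ∞ f) (u : E₁ × E₂)
    (hu : (fderiv ℝ f u ∘L .inr ℝ E₁ E₂).IsInvertible) :
    ∃ ψ : E₁ → E₂, ψ u.1 = u.2 ∧ (∀ᶠ x in 𝓝 u.1, ContDiffAt ℝ ∞ ψ x) ∧
      (∀ᶠ x in 𝓝 u.1, f (x, ψ x) = f u) ∧ ∀ᶠ v in 𝓝 u, f v = f u ↔ ψ v.1 = v.2 := by
  have hinf : (∞ : WithTop ℕ∞) ≠ 0 := by simp
  refine ⟨hf.contDiffAt.implicitFunction hinf hu,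
    hf.contDiffAt.implicitFunction_apply_self hinf hu, ?_,
    hf.contDiffAt.eventually_apply_implicitFunction hinf hu,
    hf.contDiffAt.eventually_apply_eq_iff_implicitFunction hinf hu⟩
  set ψ := hf.contDiffAt.implicitFunction hinf hu
  have hψu : ψ u.1 = u.2 := hf.contDiffAt.implicitFunction_apply_self hinf hu
  -- C¹ at a point spreads to a neighbourhood; C^∞ at a point does not, since the neighbourhood may
  -- shrink with the order.
  have hψ1 : ContDiffAt ℝ 1 ψ u.1 :=
    (hf.contDiffAt.contDiffAt_implicitFunction hinf hu).of_le (by norm_cast)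
  have hcont : ∀ᶠ x in 𝓝 u.1, ContinuousAt ψ x :=
    (hψ1.eventually (by simp)).mono fun x hx => hx.continuousAt
  have hinv : ∀ᶠ v in 𝓝 u, (fderiv ℝ f v ∘L .inr ℝ E₁ E₂).IsInvertible := by
    obtain ⟨e, he⟩ := hu
    have hc : ContinuousAt (fun v => fderiv ℝ f v ∘L .inr ℝ E₁ E₂) u :=
      ((hf.continuous_fderiv (by simp)).clm_comp continuous_const).continuousAt
    have hn := ContinuousLinearEquiv.nhds e
    rw [he] at hn
    filter_upwards [hc hn] with v hv
    exact hv
  have hpair : Filter.Tendsto (fun x => (x, ψ x)) (𝓝 u.1) (𝓝 u) := by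
    have : ContinuousAt (fun x => (x, ψ x)) u.1 := continuousAt_id.prodMk hψ1.continuousAt
    have h2 := this.tendsto
    simpa only [hψu] using h2
  filter_upwards [hcont.eventually_nhds, hpair.eventually hinv,
    (hf.contDiffAt.eventually_apply_implicitFunction hinf hu).eventually_nhds] with x hx hix hex
  -- A second implicit function based at w is smooth at x, and local uniqueness identifies it with ψ
  -- near x.
  set w : E₁ × E₂ := (x, ψ x)
  have h1 := hf.contDiffAt.eventually_apply_eq_iff_implicitFunction (u := w) hinf hix
  have hcw : Filter.Tendsto (fun x => (x, ψ x)) (𝓝 x) (𝓝 w) :=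
    (continuousAt_id.prodMk hx.self_of_nhds)
  have h2 := hcw.eventually h1
  have h3 := hf.contDiffAt.contDiffAt_implicitFunction (u := w) hinf hix
  refine h3.congr_of_eventuallyEq ?_
  filter_upwards [h2, hex] with z hz hez
  exact (hz.1 (hez.trans hex.self_of_nhds.symm)).symm

lemma neg_one_le_one_real : (-1 : ℝ) ≤ 1 := by norm_num

/-- The primitive `s ↦ ∫ r in 0..s, u r` of a path on `[-1, 1]`. -/
noncomputable def primitiveL (E : Type*) [NormedAddCommGroup E] [NormedSpace ℝ E] :
    C(Icc (-1 : ℝ) 1, E) →L[ℝ] C(Icc (-1 : ℝ) 1, E) :=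
  LinearMap.mkContinuous
    { toFun := fun u =>
        ⟨fun s => ∫ r in (0 : ℝ)..s, u (projIcc (-1) 1 neg_one_le_one_real r),
          (intervalIntegral.continuous_primitive (fun a b =>
            (u.continuous.comp (continuous_projIcc (h := neg_one_le_one_real))).intervalIntegrable a b) 0).comp
              continuous_subtype_val⟩
      map_add' := fun u v => by
        ext s
        simp only [ContinuousMap.add_apply, ContinuousMap.coe_mk]
        exact intervalIntegral.integral_add
          ((u.continuous.comp (continuous_projIcc (h := neg_one_le_one_real))).intervalIntegrable _ _)
          ((v.continuous.comp (continuous_projIcc (h := neg_one_le_one_real))).intervalIntegrable _ _)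
      map_smul' := fun c u => by
        ext s
        simp } 1
    (fun u => by
      rw [ContinuousMap.norm_le _ (by positivity)]
      rintro ⟨s, hs⟩
      refine (intervalIntegral.norm_integral_le_of_norm_le_const
        (fun r _ => u.norm_coe_le_norm (projIcc (-1) 1 neg_one_le_one_real r))).trans ?_
      rw [one_mul]
      refine mul_le_of_le_one_right (norm_nonneg u) ?_
      simpa [abs_le] using hs)

lemma primitiveL_apply {E : Type*} [NormedAddCommGroup E] [NormedSpace ℝ E]
    (u : C(Icc (-1 : ℝ) 1, E)) (s : Icc (-1 : ℝ) 1) :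
    primitiveL E u s = ∫ r in (0 : ℝ)..s, u (projIcc (-1) 1 neg_one_le_one_real r) := rfl

/-- Substitution q ↦ r q in the integral. It turns a solution of the path equation with parameter t
into one with parameter r t. -/
lemma primitiveL_comp_scale {E : Type*} [NormedAddCommGroup E] [NormedSpace ℝ E]
    (u : C(Icc (-1 : ℝ) 1, E)) {r : ℝ} (s : Icc (-1 : ℝ) 1)
    (m : C(Icc (-1 : ℝ) 1, Icc (-1 : ℝ) 1)) (hm : ∀ s, (m s : ℝ) = r * s) :
    r • primitiveL E (u.comp m) s = primitiveL E u (m s) := by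
  rw [primitiveL_apply, primitiveL_apply, hm]
  have : ∀ q ∈ uIcc (0 : ℝ) s, (u.comp m) (projIcc (-1) 1 neg_one_le_one_real q) =
      (fun w => u (projIcc (-1) 1 neg_one_le_one_real w)) (r * q) := by
    intro q hq
    have hq' : q ∈ Icc (-1 : ℝ) 1 :=
      (uIcc_subset_Icc (by constructor <;> norm_num) s.2) hq
    have : projIcc (-1 : ℝ) 1 neg_one_le_one_real (r * q) = m ⟨q, hq'⟩ := by
      rw [projIcc_of_mem _ (by rw [← hm ⟨q, hq'⟩]; exact (m ⟨q, hq'⟩).2)]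
      exact Subtype.ext (hm ⟨q, hq'⟩).symm
    simp only [ContinuousMap.comp_apply]
    rw [projIcc_of_mem _ hq', this]
  rw [intervalIntegral.integral_congr this,
    intervalIntegral.smul_integral_comp_mul_left
      (fun w => u (projIcc (-1 : ℝ) 1 neg_one_le_one_real w)) r, mul_zero]

/-- A smooth vector field has a smooth local flow near every point. -/
lemma exists_smooth_localFlow {E : Type*} [NormedAddCommGroup E] [NormedSpace ℝ E]
    [CompleteSpace E] {V : E → E} (hV : ContDiff ℝ ∞ V) (p₀ : E) :
    ∃ Φ : ℝ × E → E, (∀ᶠ q in 𝓝 ((0 : ℝ), p₀), ContDiffAt ℝ ∞ Φ q) ∧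
      (∀ᶠ p in 𝓝 p₀, Φ (0, p) = p) ∧
      ∀ᶠ q in 𝓝 ((0 : ℝ), p₀), HasDerivAt (fun t => Φ (t, q.2)) (V (Φ q)) q.1 := by
  let I := Icc (-1 : ℝ) 1
  let cst : E →L[ℝ] C(I, E) := ContinuousLinearMap.const ℝ I
  let Vc : C(E, E) := ⟨V, hV.continuous⟩
  -- Zeros of f are paths y(s) = p + t ∫₀ˢ V(y): trajectories rescaled to s ∈ [-1, 1], with time
  -- turned into the parameter t.
  let f : (ℝ × E) × C(I, E) → C(I, E) :=
    fun v => v.2 - cst v.1.2 - v.1.1 • primitiveL E (Vc.comp v.2)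
  have hN : ContDiff ℝ ∞ (fun y : C(I, E) => Vc.comp y) := ContinuousMap.contDiff_comp_left Vc hV
  have hf : ContDiff ℝ ∞ f := by
    refine (contDiff_snd.sub (cst.contDiff.comp (contDiff_snd.comp contDiff_fst))).sub ?_
    exact (contDiff_fst.comp contDiff_fst).smul
      ((primitiveL E).contDiff.comp (hN.comp contDiff_snd))
  let u : (ℝ × E) × C(I, E) := ((0, p₀), cst p₀)
  have hfu : f u = 0 := by simp [f, u]
  -- At t = 0 the integral term drops out, and the partial derivative in y is the identity.
  have hinv : (fderiv ℝ f u ∘L .inr ℝ (ℝ × E) C(I, E)).IsInvertible := by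
    have h1 : HasFDerivAt (fun y => f ((0, p₀), y))
        (fderiv ℝ f u ∘L .inr ℝ (ℝ × E) C(I, E)) (cst p₀) := by
      have h := (hf.differentiable (by simp) u).hasFDerivAt
      exact h.comp (cst p₀) (hasFDerivAt_prodMk_right (0, p₀) (cst p₀))
    have h2 : HasFDerivAt (fun y => f ((0, p₀), y)) (ContinuousLinearMap.id ℝ _) (cst p₀) := by
      have : (fun y => f ((0, p₀), y)) = fun y => y - cst p₀ := by
        funext y; simp [f]
      rw [this]
      exact (hasFDerivAt_id _).sub_const _
    rw [h1.unique h2]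
    exact ⟨ContinuousLinearEquiv.refl ℝ _, rfl⟩
  obtain ⟨ψ, hψu, hψs, hψe, hψi⟩ := hf.exists_smooth_implicitFunction u hinv
  have hN' : ∀ᶠ v in 𝓝 u, f v = 0 ↔ ψ v.1 = v.2 := by simpa only [hfu] using hψi
  obtain ⟨ε, hε, hεi⟩ := Metric.eventually_nhds_iff_ball.1 hN'
  have hclose : ∀ᶠ q in 𝓝 ((0 : ℝ), p₀), dist (ψ q) (cst p₀) < ε := by
    have := (hψs.self_of_nhds.continuousAt).tendsto
    rw [hψu] at this
    exact this (Metric.ball_mem_nhds _ hε)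
  obtain ⟨δ', hδ', hδall⟩ := Metric.eventually_nhds_iff_ball.1 (hψe.and (hψs.and hclose))
  obtain ⟨δ, hδ, hδδ', hδε⟩ : ∃ δ > 0, δ ≤ δ' ∧ δ ≤ ε :=
    ⟨min δ' ε, lt_min hδ' hε, min_le_left _ _, min_le_right _ _⟩
  have mem : ∀ t p, |t| < δ → dist p p₀ < δ → ((t, p) : ℝ × E) ∈ Metric.ball ((0 : ℝ), p₀) δ := by
    intro t p ht hp
    rw [Metric.mem_ball, Prod.dist_eq]
    exact max_lt (by simpa using ht) hp
  have hfix : ∀ t p, |t| < δ → dist p p₀ < δ →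
      ∀ s, ψ (t, p) s = p + t • primitiveL E (Vc.comp (ψ (t, p))) s := by
    intro t p ht hp s
    have h := (hδall _ (Metric.ball_subset_ball hδδ' (mem t p ht hp))).1
    rw [hfu] at h
    have h' := congrArg (fun y : C(I, E) => y s) h
    simp only [f, ContinuousMap.sub_apply, ContinuousMap.smul_apply,
      ContinuousMap.zero_apply] at h'
    have h'' : ψ (t, p) s - p - t • primitiveL E (Vc.comp (ψ (t, p))) s = 0 := h'
    rw [sub_sub, sub_eq_zero] at h''
    exact h''
  let one : I := ⟨1, by constructor <;> norm_num⟩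
  -- The path s ↦ ψ (t, p) (r s) solves the equation with parameter r t, so local uniqueness makes
  -- it ψ (r t, p); evaluate at s = 1.
  have hscale : ∀ t p, |t| < δ → dist p p₀ < δ → ∀ r : I,
      ψ ((r : ℝ) * t, p) one = ψ (t, p) r := by
    intro t p ht hp r
    let m : C(I, I) := ⟨fun s => ⟨(r : ℝ) * s, by
      have hr := abs_le.2 r.2
      have hs := abs_le.2 s.2
      rw [← mem_Icc.symm.trans Iff.rfl, ← abs_le, abs_mul]
      exact mul_le_one₀ hr (abs_nonneg _) hs⟩, by fun_prop⟩
    have hm : ∀ s, (m s : ℝ) = r * s := fun s => rfl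
    have hrt : |(r : ℝ) * t| < δ := by
      rw [abs_mul]
      exact (mul_le_of_le_one_left (abs_nonneg t) (abs_le.2 r.2)).trans_lt ht
    have hq := hδall _ (Metric.ball_subset_ball hδδ' (mem t p ht hp))
    have hdist : dist ((ψ (t, p)).comp m) (cst p₀) < ε := by
      rw [ContinuousMap.dist_lt_iff hε]
      intro s
      exact (ContinuousMap.dist_lt_iff hε).1 hq.2.2 (m s)
    have hv : (((r : ℝ) * t, p), (ψ (t, p)).comp m) ∈ Metric.ball u ε := by
      rw [Metric.mem_ball, Prod.dist_eq]
      exact max_lt ((mem _ p hrt hp).trans_le hδε) hdist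
    have hzero : f (((r : ℝ) * t, p), (ψ (t, p)).comp m) = 0 := by
      ext s
      have h1 := primitiveL_comp_scale (Vc.comp (ψ (t, p))) s m hm
      have h2 := hfix t p ht hp (m s)
      have h3 : ψ (t, p) (m s) - p -
          ((r : ℝ) * t) • primitiveL E ((Vc.comp (ψ (t, p))).comp m) s = 0 := by
        rw [mul_comm, mul_smul, h1, sub_sub, sub_eq_zero]
        exact h2
      exact h3
    have := (hεi _ hv).1 hzero
    simp only at this
    rw [this, ContinuousMap.comp_apply]
    congr 1
    exact Subtype.ext (by rw [hm]; simp [one])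
  refine ⟨fun q => ψ q one, ?_, ?_, ?_⟩
  · filter_upwards [hψs] with q hq
    exact (ContinuousMap.evalCLM ℝ one).contDiff.contDiffAt.comp q hq
  · filter_upwards [Metric.ball_mem_nhds p₀ hδ] with p hp
    rw [hfix 0 p (by simpa using hδ) hp]
    simp
  · filter_upwards [Metric.ball_mem_nhds ((0 : ℝ), p₀) (half_pos hδ)] with q hq
    obtain ⟨τ, p⟩ := q
    rw [Metric.mem_ball, Prod.dist_eq, max_lt_iff] at hq
    obtain ⟨hτ, hp⟩ := hq
    simp only [dist_zero_right, Real.norm_eq_abs] at hτ hp ⊢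
    have hp' : dist p p₀ < δ := by linarith
    -- With this reference parameter fixed, every endpoint at time σ is the value at σ / t of one
    -- path, and the fundamental theorem of calculus differentiates it in σ.
    set t := δ / 2 with ht_def
    have htpos : 0 < t := half_pos hδ
    have ht : |t| < δ := by rw [abs_of_pos htpos]; linarith
    have hmemI : ∀ σ, |σ| < t → σ / t ∈ I := by
      intro σ hσ
      refine abs_le.1 ?_
      rw [abs_div, abs_of_pos htpos, div_le_one htpos]
      exact hσ.le
    have hval : ∀ σ (hσ : |σ| < t), ψ (σ, p) one = ψ (t, p) ⟨σ / t, hmemI σ hσ⟩ := by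
      intro σ hσ
      rw [← hscale t p ht hp' ⟨σ / t, hmemI σ hσ⟩]
      simp only
      rw [div_mul_cancel₀ _ htpos.ne']
    let w : ℝ → E := fun r => Vc.comp (ψ (t, p)) (projIcc (-1) 1 neg_one_le_one_real r)
    have hw : Continuous w :=
      (Vc.comp (ψ (t, p))).continuous.comp (continuous_projIcc (h := neg_one_le_one_real))
    have hder : HasDerivAt (fun σ => p + t • ∫ r in (0 : ℝ)..(σ / t), w r)
        (t • (t⁻¹ • w (τ / t))) τ := by
      have h1 : HasDerivAt (fun x => ∫ r in (0 : ℝ)..x, w r) (w (τ / t)) (τ / t) :=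
        hw.integral_hasStrictDerivAt 0 (τ / t) |>.hasDerivAt
      have h2 : HasDerivAt (fun σ : ℝ => σ / t) t⁻¹ τ := by
        simpa [div_eq_mul_inv] using (hasDerivAt_id τ).mul_const t⁻¹
      exact ((h1.scomp τ h2).const_smul t).const_add p
    have hwτ : t • (t⁻¹ • w (τ / t)) = V (ψ (τ, p) one) := by
      rw [smul_smul, mul_inv_cancel₀ htpos.ne', one_smul, hval τ hτ]
      simp only [w, projIcc_of_mem _ (hmemI τ hτ)]
      rfl
    rw [hwτ] at hder
    refine hder.congr_of_eventuallyEq ?_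
    have hopen : ∀ᶠ σ in 𝓝 τ, |σ| < t := (continuous_abs.tendsto τ).eventually_lt_const hτ
    filter_upwards [hopen] with σ hσ
    rw [hval σ hσ, hfix t p ht hp']
    rfl

end Flow

/-! ### First-order linear equations by characteristics -/

section Cauchy

variable {E : Type*} [NormedAddCommGroup E] [NormedSpace ℝ E] [FiniteDimensional ℝ E]

/-- A function that is smooth near a point agrees near that point with a compactly supported
smooth function. -/
lemma ContDiffOn.exists_compactSupport_eventuallyEq {G : Type*} [NormedAddCommGroup G]
    [NormedSpace ℝ G] {Ω : Set E} (hΩ : IsOpen Ω) {p₀ : E} (hp₀ : p₀ ∈ Ω) {X : E → G}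
    (hX : ContDiffOn ℝ ∞ X Ω) :
    ∃ Y : E → G, ContDiff ℝ ∞ Y ∧ HasCompactSupport Y ∧ Y =ᶠ[𝓝 p₀] X := by
  obtain ⟨r, hr, hball⟩ := Metric.isOpen_iff.1 hΩ p₀ hp₀
  let χ : ContDiffBump p₀ := ⟨r / 4, r / 2, by positivity, by linarith⟩
  have hsupp : tsupport χ ⊆ Ω := by
    rw [χ.tsupport_eq]
    exact (Metric.closedBall_subset_ball (by change r / 2 < r; linarith)).trans hball
  refine ⟨fun x => χ x • X x, ?_, χ.hasCompactSupport.smul_right, ?_⟩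
  · rw [contDiff_iff_contDiffAt]
    intro x
    by_cases hx : x ∈ tsupport χ
    · exact χ.contDiff.contDiffAt.smul (hX.contDiffAt (hΩ.mem_nhds (hsupp hx)))
    · have : (fun x => χ x • X x) =ᶠ[𝓝 x] fun _ => 0 := by
        filter_upwards [(isClosed_tsupport χ).isOpen_compl.mem_nhds hx] with y hy
        rw [image_eq_zero_of_notMem_tsupport hy, zero_smul]
      exact contDiffAt_const.congr_of_eventuallyEq this
  · filter_upwards [χ.eventuallyEq_one] with x hx
    rw [hx, Pi.one_apply, one_smul]

lemma eq_of_hasDerivAt_zero {G : Type*} [NormedAddCommGroup G] [NormedSpace ℝ G] {g : ℝ → G}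
    {r a b : ℝ} (hg : ∀ t, |t| < r → HasDerivAt g 0 t) (ha : |a| < r) (hb : |b| < r) :
    g a = g b := by
  have hmem : ∀ t, t ∈ Ioo (-r) r → |t| < r := fun t ht => abs_lt.2 ht
  exact isOpen_Ioo.is_const_of_deriv_eq_zero isPreconnected_Ioo
    (fun t ht => (hg t (hmem t ht)).differentiableAt.differentiableWithinAt)
    (fun t ht => (hg t (hmem t ht)).deriv) (abs_lt.1 ha) (abs_lt.1 hb)

/-- Uniqueness in the Cauchy problem `X h = 0`, `h = 0` on a level set of `ℓ`, for a vector
field `X` transverse to the level sets of the linear form `ℓ`. -/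
theorem eventually_eq_zero_of_fderiv_eq_zero (ℓ : E →L[ℝ] ℝ) {Ω : Set E} (hΩ : IsOpen Ω)
    {p₀ : E} (hp₀ : p₀ ∈ Ω) {X : E → E} (hX : ContDiffOn ℝ ∞ X Ω) (hℓ : ∀ x ∈ Ω, ℓ (X x) = 1)
    {h : E → ℝ} (hh : DifferentiableOn ℝ h Ω) (hXh : ∀ x ∈ Ω, fderiv ℝ h x (X x) = 0)
    (h0 : ∀ x ∈ Ω, ℓ x = ℓ p₀ → h x = 0) : ∀ᶠ x in 𝓝 p₀, h x = 0 := by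
  have : CompleteSpace E := FiniteDimensional.complete ℝ E
  obtain ⟨Y, hY, -, hYX⟩ := hX.exists_compactSupport_eventuallyEq hΩ hp₀
  obtain ⟨Φ, hΦs, hΦ0, hΦd⟩ := exists_smooth_localFlow hY p₀
  have hΦc : Filter.Tendsto Φ (𝓝 ((0 : ℝ), p₀)) (𝓝 p₀) := by
    have := hΦs.self_of_nhds.continuousAt.tendsto
    rwa [hΦ0.self_of_nhds] at this
  obtain ⟨r, hr, hball⟩ := Metric.eventually_nhds_iff_ball.1
    (hΦd.and (hΦc.eventually (hYX.and (hΩ.mem_nhds hp₀))))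
  have hτ : ∀ᶠ p in 𝓝 p₀, |ℓ p₀ - ℓ p| < r := by
    have : Filter.Tendsto (fun p => |ℓ p₀ - ℓ p|) (𝓝 p₀) (𝓝 |ℓ p₀ - ℓ p₀|) :=
      (Continuous.tendsto (by fun_prop) p₀)
    rw [sub_self, abs_zero] at this
    exact this.eventually_lt_const hr
  filter_upwards [hΦ0, hτ, Metric.ball_mem_nhds p₀ hr] with p hp0 hpτ hp
  have key : ∀ t, |t| < r → HasDerivAt (fun t => Φ (t, p)) (X (Φ (t, p))) t ∧ Φ (t, p) ∈ Ω := by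
    intro t ht
    have hm : ((t, p) : ℝ × E) ∈ Metric.ball ((0 : ℝ), p₀) r := by
      rw [Metric.mem_ball, Prod.dist_eq]
      exact max_lt (by simpa using ht) hp
    obtain ⟨h1, h2, h3⟩ := hball _ hm
    exact ⟨h2 ▸ h1, h3⟩
  have h0r : |(0 : ℝ)| < r := by simpa using hr
  -- ℓ grows at unit speed along the flow, so at time ℓ p₀ - ℓ p the trajectory from p meets the
  -- level set carrying the data.
  have e1 : ℓ (Φ (ℓ p₀ - ℓ p, p)) - (ℓ p₀ - ℓ p) = ℓ (Φ (0, p)) - 0 :=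
    eq_of_hasDerivAt_zero (g := fun t => ℓ (Φ (t, p)) - t) (fun t ht => by
      have := (ℓ.hasFDerivAt.comp_hasDerivAt t (key t ht).1).sub (hasDerivAt_id t)
      rw [hℓ _ (key t ht).2, sub_self] at this
      exact this) hpτ h0r
  have e2 : h (Φ (ℓ p₀ - ℓ p, p)) = h (Φ (0, p)) :=
    eq_of_hasDerivAt_zero (g := fun t => h (Φ (t, p))) (fun t ht => by
      have hd := (hh.differentiableAt (hΩ.mem_nhds (key t ht).2)).hasFDerivAt
      have := hd.comp_hasDerivAt t (key t ht).1
      rw [hXh _ (key t ht).2] at this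
      exact this) hpτ h0r
  rw [hp0] at e1 e2
  rw [← e2]
  exact h0 _ (key _ hpτ).2 (by linarith)

/-- Local existence in the Cauchy problem `X h = k`, `h = 0` on a level set of `ℓ`, for a vector
field `X` transverse to the level sets of the linear form `ℓ`. -/
theorem exists_smooth_fderiv_eq (ℓ : E →L[ℝ] ℝ) {Ω : Set E} (hΩ : IsOpen Ω)
    {p₀ : E} (hp₀ : p₀ ∈ Ω) {X : E → E} (hX : ContDiffOn ℝ ∞ X Ω) (hℓ : ∀ x ∈ Ω, ℓ (X x) = 1)
    {k : E → ℝ} (hk : ContDiffOn ℝ ∞ k Ω) :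
    ∃ U ⊆ Ω, IsOpen U ∧ p₀ ∈ U ∧ ∃ h : E → ℝ, ContDiffOn ℝ ∞ h U ∧
      (∀ x ∈ U, fderiv ℝ h x (X x) = k x) ∧ ∀ x ∈ U, ℓ x = ℓ p₀ → h x = 0 := by
  have : CompleteSpace E := FiniteDimensional.complete ℝ E
  obtain ⟨Y, hY, hYc, hYX⟩ := hX.exists_compactSupport_eventuallyEq hΩ hp₀
  obtain ⟨m, hm, hmc, hmk⟩ := hk.exists_compactSupport_eventuallyEq hΩ hp₀
  -- The extra coordinate accumulates ∫ k along the trajectory.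
  let V : E × ℝ → E × ℝ := fun z => (Y z.1, m z.1)
  have hV : ContDiff ℝ ∞ V := (hY.comp contDiff_fst).prodMk (hm.comp contDiff_fst)
  obtain ⟨K, hK⟩ : ∃ K, LipschitzWith K V := by
    obtain ⟨K₁, h₁⟩ := ContDiff.lipschitzWith_of_hasCompactSupport hYc hY (by simp)
    obtain ⟨K₂, h₂⟩ := ContDiff.lipschitzWith_of_hasCompactSupport hmc hm (by simp)
    exact ⟨_, (h₁.comp LipschitzWith.prod_fst).prodMk (h₂.comp LipschitzWith.prod_fst)⟩
  obtain ⟨Φ, hΦs, hΦ0, hΦd⟩ := exists_smooth_localFlow hV (p₀, (0 : ℝ))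
  have hΦc : Filter.Tendsto (fun q => (Φ q).1) (𝓝 ((0 : ℝ), (p₀, (0 : ℝ)))) (𝓝 p₀) := by
    have := hΦs.self_of_nhds.continuousAt.fst.tendsto
    rwa [hΦ0.self_of_nhds] at this
  obtain ⟨r, hr, hball⟩ := Metric.eventually_nhds_iff_ball.1
    ((hΦd.and hΦs).and (hΦc.eventually ((hYX.and hmk).and (hΩ.mem_nhds hp₀))))
  obtain ⟨r', hr', hball'⟩ := Metric.eventually_nhds_iff_ball.1 hΦ0
  have key : ∀ t p, |t| < r → dist p p₀ < r →
      HasDerivAt (fun t => Φ (t, (p, 0))) (V (Φ (t, (p, 0)))) t ∧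
      ContDiffAt ℝ ∞ Φ (t, (p, 0)) ∧ Y (Φ (t, (p, 0))).1 = X (Φ (t, (p, 0))).1 ∧
      m (Φ (t, (p, 0))).1 = k (Φ (t, (p, 0))).1 ∧ (Φ (t, (p, 0))).1 ∈ Ω := by
    intro t p ht hp
    have hmem : ((t, (p, 0)) : ℝ × (E × ℝ)) ∈ Metric.ball ((0 : ℝ), (p₀, (0 : ℝ))) r := by
      simp only [Metric.mem_ball, Prod.dist_eq, dist_self]
      exact max_lt (by simpa using ht) (max_lt hp hr)
    obtain ⟨⟨h1, h2⟩, ⟨h3, h4⟩, h5⟩ := hball _ hmem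
    exact ⟨h1, h2, h3, h4, h5⟩
  have key0 : ∀ p, dist p p₀ < r' → Φ (0, (p, 0)) = (p, 0) := by
    intro p hp
    refine hball' (p, 0) ?_
    simp only [Metric.mem_ball, Prod.dist_eq, dist_self]
    exact max_lt hp hr'
  -- With r / 4 bounding both the hitting time and the later shift σ, the shifted hitting time stays
  -- below r / 2 and all flow times below r.
  let U : Set E := {p | |ℓ p₀ - ℓ p| < r / 4} ∩ (Metric.ball p₀ r ∩ Metric.ball p₀ r')
  have hUo : IsOpen U := by
    refine (isOpen_lt (by fun_prop) continuous_const).inter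
      (Metric.isOpen_ball.inter Metric.isOpen_ball)
  have h0r : |(0 : ℝ)| < r := by simpa using hr
  -- Minus the integral of k from p to the level set: the value that grows at rate k and is 0 there.
  refine ⟨U, ?_, hUo, ?_, fun p => -(Φ (ℓ p₀ - ℓ p, (p, 0))).2, ?_, ?_, ?_⟩
  · rintro p ⟨-, hp, hp'⟩
    have := (key 0 p h0r hp).2.2.2.2
    rwa [key0 p hp'] at this
  · exact ⟨by simp [hr], Metric.mem_ball_self hr, Metric.mem_ball_self hr'⟩
  · intro p hp
    have h1 := (key (ℓ p₀ - ℓ p) p (hp.1.trans (by linarith)) hp.2.1).2.1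
    have h2 : ContDiffAt ℝ ∞ (fun p : E => (ℓ p₀ - ℓ p, ((p, 0) : E × ℝ))) p := by fun_prop
    exact ((contDiff_snd.contDiffAt.comp _ (h1.comp p h2)).neg).contDiffWithinAt
  · intro p hp
    obtain ⟨hpτ, hpr, hpr'⟩ := hp
    simp only [mem_ofPred_eq] at hpτ
    set h : E → ℝ := fun p => -(Φ (ℓ p₀ - ℓ p, (p, 0))).2 with hh
    let c : ℝ → E := fun σ => (Φ (σ, (p, 0))).1
    have hp0 := key0 p hpr'
    have hc0 : c 0 = p := by simp only [c, hp0]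
    have hcd : HasDerivAt c (X p) 0 := by
      have h1 := (key 0 p h0r hpr).1.fst
      have h2 := (key 0 p h0r hpr).2.2.1
      simp only [hp0, V] at h1 h2
      rwa [h2] at h1
    have hwd : HasDerivAt (fun σ => (Φ (σ, (p, 0))).2) (k p) 0 := by
      have h1 := (key 0 p h0r hpr).1.snd
      have h2 := (key 0 p h0r hpr).2.2.2.1
      simp only [hp0, V] at h1 h2
      rwa [h2] at h1
    have hcℓ : ∀ σ, |σ| < r → ℓ (c σ) = ℓ p + σ := by
      intro σ hσ
      have e1 : ℓ (c σ) - σ = ℓ (c 0) - 0 :=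
        eq_of_hasDerivAt_zero (g := fun t => ℓ (c t) - t) (fun t ht => by
          obtain ⟨k1, -, k2, -, k3⟩ := key t p ht hpr
          have := (ℓ.hasFDerivAt.comp_hasDerivAt t k1.fst).sub (hasDerivAt_id t)
          simp only [V] at this
          rw [k2, hℓ _ k3, sub_self] at this
          exact this) hσ h0r
      rw [hc0] at e1
      linarith
    have hnear : ∀ᶠ σ in 𝓝 (0 : ℝ), |σ| < r / 4 ∧ dist (c σ) p₀ < r ∧ dist (c σ) p₀ < r' := by
      have h1 : ∀ᶠ σ in 𝓝 (0 : ℝ), |σ| < r / 4 := by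
        refine (continuous_abs.tendsto (0 : ℝ)).eventually_lt_const ?_
        simpa using hr
      have h2 : ∀ᶠ σ in 𝓝 (0 : ℝ), c σ ∈ Metric.ball p₀ r ∩ Metric.ball p₀ r' := by
        refine hcd.continuousAt ((Metric.isOpen_ball.inter Metric.isOpen_ball).mem_nhds ?_)
        rw [hc0]
        exact ⟨hpr, hpr'⟩
      filter_upwards [h1, h2] with σ a b
      exact ⟨a, b.1, b.2⟩
    have hhc : (fun σ => h (c σ)) =ᶠ[𝓝 0] fun σ => h p + (Φ (σ, (p, 0))).2 := by
      filter_upwards [hnear] with σ hσ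
      obtain ⟨hσ, hcr, hcr'⟩ := hσ
      set τ := ℓ p₀ - ℓ p
      -- V ignores the accumulated coordinate, so restarting at c σ with accumulator 0 only shifts
      -- time and subtracts what was already accumulated. ODE uniqueness uses the Lipschitz bound
      -- from compact support.
      have hshift : EqOn (fun t => Φ (t, (c σ, 0)))
          (fun t => Φ (t + σ, (p, 0)) - (0, (Φ (σ, (p, 0))).2)) (Ioo (-(r / 2)) (r / 2)) := by
        refine ODE_solution_unique_of_mem_Ioo (v := fun _ => V) (s := fun _ => univ) (K := K)
          (t₀ := 0) (fun _ _ => hK.lipschitzOnWith) ⟨by linarith, by linarith⟩ ?_ ?_ ?_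
        · intro t ht
          exact ⟨(key t (c σ) ((abs_lt.2 ht).trans (by linarith)) hcr).1, mem_univ _⟩
        · intro t ht
          refine ⟨?_, mem_univ _⟩
          have hts : |t + σ| < r := by
            have := abs_add_le t σ
            have := abs_lt.2 ht
            linarith
          have hd := (key (t + σ) p hts hpr).1
          have := (hd.comp_add_const t σ).sub_const ((0, (Φ (σ, (p, 0))).2) : E × ℝ)
          have hVeq : V (Φ (t + σ, (p, 0)) - ((0, (Φ (σ, (p, 0))).2) : E × ℝ)) =
              V (Φ (t + σ, (p, 0))) := by simp [V]
          rw [hVeq]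
          exact this
        · simp only [key0 (c σ) hcr', zero_add]
          ext <;> simp [c]
      have hτσ : τ - σ ∈ Ioo (-(r / 2)) (r / 2) := by
        refine abs_lt.1 ?_
        have := abs_sub τ σ
        linarith
      have := hshift hτσ
      simp only [sub_add_cancel] at this
      simp only [hh]
      rw [hcℓ σ (hσ.trans (by linarith)), show ℓ p₀ - (ℓ p + σ) = τ - σ by ring, this]
      simp only [Prod.snd_sub]
      ring
    have hdiff : DifferentiableAt ℝ h p := by
      have h1 := (key (ℓ p₀ - ℓ p) p (hpτ.trans (by linarith)) hpr).2.1
      have h2 : ContDiffAt ℝ ∞ (fun p : E => (ℓ p₀ - ℓ p, ((p, 0) : E × ℝ))) p := by fun_prop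
      exact ((contDiff_snd.contDiffAt.comp _ (h1.comp p h2)).neg).differentiableAt (by simp)
    have d1 : HasDerivAt (fun σ => h (c σ)) (fderiv ℝ h p (X p)) 0 := by
      have hf : HasFDerivAt h (fderiv ℝ h p) (c 0) := by
        rw [hc0]; exact hdiff.hasFDerivAt
      exact hf.comp_hasDerivAt 0 hcd
    have d2 : HasDerivAt (fun σ => h (c σ)) (k p) 0 :=
      (hwd.const_add (h p)).congr_of_eventuallyEq hhc
    exact d1.unique d2
  · intro p hp hpℓ
    simp only [hpℓ, sub_self, key0 p hp.2.2, neg_zero]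

end Cauchy

/-! ### Compatible systems for two commuting vector fields -/

section Commuting

variable {E : Type*} [NormedAddCommGroup E] [NormedSpace ℝ E]

lemma ContDiffAt.fderiv_symm {G : Type*} [NormedAddCommGroup G] [NormedSpace ℝ G] {f : E → G}
    {x : E} (hf : ContDiffAt ℝ ∞ f x) (v w : E) :
    fderiv ℝ (fderiv ℝ f) x v w = fderiv ℝ (fderiv ℝ f) x w v :=
  (hf.isSymmSndFDerivAt (by simp only [minSmoothness_of_isRCLikeNormedField]; norm_cast)).eq
    v w

lemma ContDiffAt.differentiableAt_fderiv {G : Type*} [NormedAddCommGroup G] [NormedSpace ℝ G]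
    {f : E → G} {x : E} (hf : ContDiffAt ℝ ∞ f x) : DifferentiableAt ℝ (fderiv ℝ f) x :=
  (hf.fderiv_right (m := 1) (by norm_cast)).differentiableAt (by simp)

/-- Directional derivatives along commuting vector fields commute. -/
lemma ContDiffAt.fderiv_fderiv_comm {f : E → ℝ} {X Y : E → E} {x : E} (hf : ContDiffAt ℝ ∞ f x)
    (hX : DifferentiableAt ℝ X x) (hY : DifferentiableAt ℝ Y x)
    (hXY : fderiv ℝ Y x (X x) = fderiv ℝ X x (Y x)) :
    fderiv ℝ (fun y => fderiv ℝ f y (Y y)) x (X x) =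
      fderiv ℝ (fun y => fderiv ℝ f y (X y)) x (Y x) := by
  have hd := hf.differentiableAt_fderiv
  rw [fderiv_clm_apply hd hY, fderiv_clm_apply hd hX]
  simp only [add_apply, ContinuousLinearMap.comp_apply,
    ContinuousLinearMap.flip_apply]
  rw [hXY, hf.fderiv_symm]

lemma ContDiffOn.fderiv_clm_apply_of_isOpen {G : Type*} [NormedAddCommGroup G] [NormedSpace ℝ G]
    {U : Set E} (hU : IsOpen U) {f : E → G} {X : E → E} (hf : ContDiffOn ℝ ∞ f U)
    (hX : ContDiffOn ℝ ∞ X U) : ContDiffOn ℝ ∞ (fun y => fderiv ℝ f y (X y)) U :=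
  (hf.fderiv_of_isOpen hU (by simp)).clm_apply hX

/-- Local solvability of the system `X₁ f = k₁`, `X₂ f = k₂` for commuting vector fields `X₁`,
`X₂` under the compatibility condition `X₁ k₂ = X₂ k₁`. -/
theorem exists_smooth_fderiv_eq_of_commute [FiniteDimensional ℝ E] (ℓ₁ ℓ₂ : E →L[ℝ] ℝ)
    {Ω : Set E} (hΩ : IsOpen Ω) {p₀ : E} (hp₀ : p₀ ∈ Ω) {X₁ X₂ : E → E}
    (hX₁ : ContDiffOn ℝ ∞ X₁ Ω) (hX₂ : ContDiffOn ℝ ∞ X₂ Ω)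
    (h₁₁ : ∀ x ∈ Ω, ℓ₁ (X₁ x) = 1) (h₂₂ : ∀ x ∈ Ω, ℓ₂ (X₂ x) = 1) (h₂₁ : ∀ x ∈ Ω, ℓ₂ (X₁ x) = 0)
    (hcomm : ∀ x ∈ Ω, fderiv ℝ X₂ x (X₁ x) = fderiv ℝ X₁ x (X₂ x))
    {k₁ k₂ : E → ℝ} (hk₁ : ContDiffOn ℝ ∞ k₁ Ω) (hk₂ : ContDiffOn ℝ ∞ k₂ Ω)
    (hk : ∀ x ∈ Ω, fderiv ℝ k₂ x (X₁ x) = fderiv ℝ k₁ x (X₂ x)) :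
    ∃ U ⊆ Ω, IsOpen U ∧ p₀ ∈ U ∧ ∃ f : E → ℝ, ContDiffOn ℝ ∞ f U ∧
      ∀ x ∈ U, fderiv ℝ f x (X₁ x) = k₁ x ∧ fderiv ℝ f x (X₂ x) = k₂ x := by
  obtain ⟨U, hUΩ, hU, hpU, f₁, hf₁, hXf₁, -⟩ := exists_smooth_fderiv_eq ℓ₁ hΩ hp₀ hX₁ h₁₁ hk₁
  have hX₁U := hX₁.mono hUΩ
  have hX₂U := hX₂.mono hUΩ
  have hX₂f₁ := hf₁.fderiv_clm_apply_of_isOpen hU hX₂U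
  obtain ⟨U', hU'U, hU', hpU', f₂, hf₂, hXf₂, hf₂0⟩ :=
    exists_smooth_fderiv_eq ℓ₂ hU hpU hX₂U (fun x hx => h₂₂ x (hUΩ hx))
      ((hk₂.mono hUΩ).sub hX₂f₁)
  have hX₁f₂ := hf₂.fderiv_clm_apply_of_isOpen hU' (hX₁U.mono hU'U)
  -- The correction f₂ must not spoil X₁ f₁ = k₁. Here X₂ (X₁ f₂) = X₁ (k₂ - X₂ f₁) = X₁ k₂ - X₂ k₁
  -- = 0, and X₁ f₂ has zero Cauchy data.
  have hev : ∀ᶠ x in 𝓝 p₀, fderiv ℝ f₂ x (X₁ x) = 0 := by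
    refine eventually_eq_zero_of_fderiv_eq_zero (h := fun x => fderiv ℝ f₂ x (X₁ x)) ℓ₂ hU' hpU'
      (hX₂U.mono hU'U) (fun x hx => h₂₂ x (hUΩ (hU'U hx)))
      (hX₁f₂.differentiableOn (by simp)) ?_ ?_
    · intro x hx
      have hxU := hU'U hx
      have hxΩ := hUΩ hxU
      have dX₁ := (hX₁.contDiffAt (hΩ.mem_nhds hxΩ)).differentiableAt (by simp)
      have dX₂ := (hX₂.contDiffAt (hΩ.mem_nhds hxΩ)).differentiableAt (by simp)
      rw [(hf₂.contDiffAt (hU'.mem_nhds hx)).fderiv_fderiv_comm dX₂ dX₁ (hcomm x hxΩ).symm]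
      have e1 : (fun y => fderiv ℝ f₂ y (X₂ y)) =ᶠ[𝓝 x] fun y => k₂ y - fderiv ℝ f₁ y (X₂ y) := by
        filter_upwards [hU'.mem_nhds hx] with y hy using hXf₂ y hy
      have e2 : (fun y => fderiv ℝ f₁ y (X₁ y)) =ᶠ[𝓝 x] k₁ := by
        filter_upwards [hU.mem_nhds hxU] with y hy using hXf₁ y hy
      have dk₂ : DifferentiableAt ℝ k₂ x :=
        (hk₂.contDiffAt (hΩ.mem_nhds hxΩ)).differentiableAt (by simp)
      have df₁ : DifferentiableAt ℝ (fun y => fderiv ℝ f₁ y (X₂ y)) x :=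
        (hX₂f₁.contDiffAt (hU.mem_nhds hxU)).differentiableAt (by simp)
      rw [e1.fderiv_eq, fderiv_fun_sub dk₂ df₁, sub_apply,
        (hf₁.contDiffAt (hU.mem_nhds hxU)).fderiv_fderiv_comm dX₁ dX₂ (hcomm x hxΩ),
        e2.fderiv_eq, hk x hxΩ, sub_self]
    · intro x hx hxℓ
      have hd := (hf₂.differentiableOn (by simp)).differentiableAt (hU'.mem_nhds hx)
      -- Since ℓ₂ kills X₁ x, this line stays in the level set on which f₂ vanishes.
      have hline : HasDerivAt (fun t : ℝ => x + t • X₁ x) (X₁ x) 0 := by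
        simpa using ((hasDerivAt_id (0 : ℝ)).smul_const (X₁ x)).const_add x
      have hcomp : HasDerivAt (fun t : ℝ => f₂ (x + t • X₁ x)) (fderiv ℝ f₂ x (X₁ x)) 0 := by
        have hf : HasFDerivAt f₂ (fderiv ℝ f₂ x) (x + (0 : ℝ) • X₁ x) := by
          simpa using hd.hasFDerivAt
        exact hf.comp_hasDerivAt 0 hline
      have hmem : ∀ᶠ t in 𝓝 (0 : ℝ), x + t • X₁ x ∈ U' :=
        hline.continuousAt (by simpa using hU'.mem_nhds hx)
      have hz : (fun t : ℝ => f₂ (x + t • X₁ x)) =ᶠ[𝓝 0] fun _ => 0 := by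
        filter_upwards [hmem] with t ht
        refine hf₂0 _ ht ?_
        rw [map_add, map_smul, h₂₁ x (hUΩ (hU'U hx)), smul_zero, add_zero, hxℓ]
      exact hcomp.unique ((hasDerivAt_const (0 : ℝ) (0 : ℝ)).congr_of_eventuallyEq hz)
  obtain ⟨S, hSsub, hSo, hpS⟩ := mem_nhds_iff.1 (hev : {x | fderiv ℝ f₂ x (X₁ x) = 0} ∈ 𝓝 p₀)
  refine ⟨U' ∩ S, fun x hx => hUΩ (hU'U hx.1), hU'.inter hSo, ⟨hpU', hpS⟩,
    fun x => f₁ x + f₂ x, ((hf₁.mono hU'U).add hf₂).mono inter_subset_left, ?_⟩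
  rintro x ⟨hx, hxS⟩
  have d₁ := (hf₁.differentiableOn (by simp)).differentiableAt (hU.mem_nhds (hU'U hx))
  have d₂ := (hf₂.differentiableOn (by simp)).differentiableAt (hU'.mem_nhds hx)
  rw [fderiv_fun_add d₁ d₂, add_apply, add_apply,
    hXf₁ x (hU'U hx), hXf₂ x hx, show fderiv ℝ f₂ x (X₁ x) = 0 from hSsub hxS]
  exact ⟨by ring, by ring⟩

end Commuting

namespace Beltrami

/-! ### Partial derivatives -/

lemma contDiffOn_pd {Ω : Set Spacetime} (hΩ : IsOpen Ω) {g : Spacetime → ℝ}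
    (hg : ContDiffOn ℝ ∞ g Ω) (μ : Fin 4) : ContDiffOn ℝ ∞ (pd μ g) Ω :=
  hg.fderiv_clm_apply_of_isOpen hΩ contDiffOn_const

lemma pd_add {g h : Spacetime → ℝ} {x : Spacetime} (hg : DifferentiableAt ℝ g x)
    (hh : DifferentiableAt ℝ h x) (μ : Fin 4) :
    pd μ (fun y => g y + h y) x = pd μ g x + pd μ h x := by
  simp [pd, fderiv_fun_add hg hh]

lemma pd_sub {g h : Spacetime → ℝ} {x : Spacetime} (hg : DifferentiableAt ℝ g x)
    (hh : DifferentiableAt ℝ h x) (μ : Fin 4) :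
    pd μ (fun y => g y - h y) x = pd μ g x - pd μ h x := by
  simp [pd, fderiv_fun_sub hg hh]

lemma pd_mul {g h : Spacetime → ℝ} {x : Spacetime} (hg : DifferentiableAt ℝ g x)
    (hh : DifferentiableAt ℝ h x) (μ : Fin 4) :
    pd μ (fun y => g y * h y) x = pd μ g x * h x + g x * pd μ h x := by
  simp [pd, fderiv_fun_mul hg hh]; ring

lemma pd_const_mul {g : Spacetime → ℝ} {x : Spacetime} (hg : DifferentiableAt ℝ g x)
    (c : ℝ) (μ : Fin 4) : pd μ (fun y => c * g y) x = c * pd μ g x := by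
  simp [pd, fderiv_const_mul hg]

lemma pd_sum {ι : Type*} {s : Finset ι} {g : ι → Spacetime → ℝ} {x : Spacetime}
    (hg : ∀ i ∈ s, DifferentiableAt ℝ (g i) x) (μ : Fin 4) :
    pd μ (fun y => ∑ i ∈ s, g i y) x = ∑ i ∈ s, pd μ (g i) x := by
  simp [pd, fderiv_fun_sum hg]

lemma pd_congr {g h : Spacetime → ℝ} {x : Spacetime} (hgh : g =ᶠ[𝓝 x] h) (μ : Fin 4) :
    pd μ g x = pd μ h x := by
  simp [pd, hgh.fderiv_eq]

lemma pd_comm {g : Spacetime → ℝ} {x : Spacetime} (hg : ContDiffAt ℝ ∞ g x) (μ ν : Fin 4) :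
    pd μ (pd ν g) x = pd ν (pd μ g) x := by
  have h := hg.fderiv_fderiv_comm (X := fun _ => Pi.single μ 1) (Y := fun _ => Pi.single ν 1)
    (by fun_prop) (by fun_prop) (by simp)
  exact h

/-! ### The Levi-Civita tensor -/

/-- The Vandermonde product of the indices is antisymmetric and equals 12 at (0, 1, 2, 3). After
passing to integers all 256 index tuples are checked by evaluation. -/
lemma eps_eq (μ ν α β : Fin 4) : eps μ ν α β =
    (((β : ℕ) : ℝ) - (α : ℕ)) * ((β : ℕ) - (ν : ℕ)) * ((β : ℕ) - (μ : ℕ)) *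
      ((α : ℕ) - (ν : ℕ)) * ((α : ℕ) - (μ : ℕ)) * ((ν : ℕ) - (μ : ℕ)) / 12 := by
  have hδ : ∀ i j : Fin 4, (if i = j then (1 : ℝ) else 0) = ((if i = j then 1 else 0 : ℤ) : ℝ) := by
    intro i j; split_ifs <;> simp
  rw [eps, eq_div_iff (by norm_num)]
  simp only [Matrix.det_succ_row_zero, Matrix.det_unique, Fin.sum_univ_succ, Matrix.of_apply,
    Matrix.submatrix_apply, hδ]
  norm_cast
  revert μ ν α β
  decide +kernel

/-- Cubic interpolation at 0, 1, 2, 3, so that concrete components become arithmetic. -/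
lemma eta_eq (μ : Fin 4) :
    eta μ = 1 - (1 - ((μ : ℕ) : ℝ)) * (2 - (μ : ℕ)) * (3 - (μ : ℕ)) / 3 := by
  fin_cases μ <;> norm_num [eta]

lemma eta_mul_self (μ : Fin 4) : eta μ * eta μ = 1 := by
  fin_cases μ <;> simp [eta]

lemma F_antisymm (A : Spacetime → Fin 4 → ℝ) (μ ν : Fin 4) (x : Spacetime) :
    F A μ ν x = -F A ν μ x := by
  simp [F]

@[simp] lemma F_self (A : Spacetime → Fin 4 → ℝ) (μ : Fin 4) (x : Spacetime) :
    F A μ μ x = 0 := by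
  simp [F]

/-- The contraction `½ ε^{μναβ} T_{αβ}` of the Levi-Civita tensor with a tensor `T`. -/
noncomputable def dual (T : Fin 4 → Fin 4 → ℝ) (μ ν : Fin 4) : ℝ :=
  (1 / 2) * ∑ α, ∑ β, epsUp μ ν α β * T α β

/-- The Pfaffian of a tensor with two lower indices. -/
def pfaffian (T : Fin 4 → Fin 4 → ℝ) : ℝ := T 0 1 * T 2 3 - T 0 2 * T 1 3 + T 0 3 * T 1 2

/-- The matrix of the dual tensor in terms of the components of an antisymmetric tensor. -/
lemma dual_eq {T : Fin 4 → Fin 4 → ℝ} (hT : ∀ μ ν, T μ ν = -T ν μ) (μ ν : Fin 4) :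
    dual T μ ν = (![![0, -T 2 3, T 1 3, -T 1 2], ![T 2 3, 0, -T 0 3, T 0 2],
      ![-T 1 3, T 0 3, 0, -T 0 1], ![T 1 2, -T 0 2, T 0 1, 0]] : Fin 4 → Fin 4 → ℝ) μ ν := by
  have h10 := hT 1 0
  have h20 := hT 2 0
  have h30 := hT 3 0
  have h21 := hT 2 1
  have h31 := hT 3 1
  have h32 := hT 3 2
  fin_cases μ <;> fin_cases ν <;>
    norm_num [dual, epsUp, eps_eq, eta_eq, Fin.sum_univ_four] <;>
    linarith

lemma sum_dual_mul_eq (T S : Fin 4 → Fin 4 → ℝ) :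
    ∑ μ, ∑ ν, ∑ α, ∑ β, epsUp μ ν α β * T μ ν * S α β = 2 * ∑ μ, ∑ ν, dual S μ ν * T μ ν := by
  simp only [dual, Finset.mul_sum, Finset.sum_mul]
  refine Finset.sum_congr rfl fun μ _ => Finset.sum_congr rfl fun ν _ =>
    Finset.sum_congr rfl fun α _ => Finset.sum_congr rfl fun β _ => ?_
  ring

/-- The contraction of an antisymmetric tensor with its dual is `-Pf` times the identity. -/
lemma sum_mul_dual {T : Fin 4 → Fin 4 → ℝ} (hT : ∀ μ ν, T μ ν = -T ν μ) (μ ν : Fin 4) :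
    ∑ α, T μ α * dual T α ν = if μ = ν then pfaffian T else 0 := by
  simp only [dual_eq hT, Fin.sum_univ_four, pfaffian]
  have h00 := hT 0 0
  have h11 := hT 1 1
  have h22 := hT 2 2
  have h33 := hT 3 3
  rw [self_eq_neg] at h00 h11 h22 h33
  fin_cases μ <;> fin_cases ν <;>
    simp [h00, h11, h22, h33, hT 1 0, hT 2 0, hT 3 0, hT 2 1, hT 3 1, hT 3 2] <;> ring

lemma sum_eps_mul_mul_self {T : Fin 4 → Fin 4 → ℝ} (hT : ∀ μ ν, T μ ν = -T ν μ) :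
    ∑ μ, ∑ ν, ∑ α, ∑ β, epsUp μ ν α β * T μ ν * T α β = -8 * pfaffian T := by
  rw [sum_dual_mul_eq]
  simp only [dual_eq hT, Fin.sum_univ_four, pfaffian]
  simp [hT 1 0, hT 2 0, hT 3 0, hT 2 1, hT 3 1, hT 3 2]
  ring

lemma epsFF_eq (A : Spacetime → Fin 4 → ℝ) (x : Spacetime) :
    epsFF A x = -8 * pfaffian fun μ ν => F A μ ν x :=
  sum_eps_mul_mul_self fun μ ν => F_antisymm A μ ν x

end Beltrami

namespace Beltrami

/-! ### Field strength, dual field strength and current -/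

/-- The dual field strength `½ ε^{μναβ} F_{αβ}`. -/
noncomputable def dualF (A : Spacetime → Fin 4 → ℝ) (μ ν : Fin 4) (x : Spacetime) : ℝ :=
  dual (fun α β => F A α β x) μ ν

/-- The current `J^μ = ∇_ν F^{μν}`. -/
noncomputable def current (A : Spacetime → Fin 4 → ℝ) (μ : Fin 4) (x : Spacetime) : ℝ :=
  ∑ ν, pd ν (FUp A μ ν) x

/-- The residual `J^μ - ½ ε^{μναβ} (∇_ν f) F_{αβ}` of the Beltrami equation. -/
noncomputable def residual (A : Spacetime → Fin 4 → ℝ) (f : Spacetime → ℝ) (μ : Fin 4)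
    (x : Spacetime) : ℝ :=
  current A μ x - ∑ ν, dualF A μ ν x * pd ν f x

section Smoothness

variable {Ω : Set Spacetime} {A : Spacetime → Fin 4 → ℝ}

lemma contDiffOn_component (hA : ContDiffOn ℝ ∞ A Ω) (ν : Fin 4) :
    ContDiffOn ℝ ∞ (fun y => A y ν) Ω :=
  contDiffOn_pi.1 hA ν

lemma contDiffOn_F (hΩ : IsOpen Ω) (hA : ContDiffOn ℝ ∞ A Ω) (μ ν : Fin 4) :
    ContDiffOn ℝ ∞ (F A μ ν) Ω :=
  (contDiffOn_pd hΩ (contDiffOn_component hA ν) μ).sub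
    (contDiffOn_pd hΩ (contDiffOn_component hA μ) ν)

lemma contDiffOn_FUp (hΩ : IsOpen Ω) (hA : ContDiffOn ℝ ∞ A Ω) (μ ν : Fin 4) :
    ContDiffOn ℝ ∞ (FUp A μ ν) Ω :=
  contDiffOn_const.mul (contDiffOn_F hΩ hA μ ν)

lemma contDiffOn_dualF (hΩ : IsOpen Ω) (hA : ContDiffOn ℝ ∞ A Ω) (μ ν : Fin 4) :
    ContDiffOn ℝ ∞ (dualF A μ ν) Ω :=
  contDiffOn_const.mul (ContDiffOn.sum fun α _ => ContDiffOn.sum fun β _ =>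
    contDiffOn_const.mul (contDiffOn_F hΩ hA α β))

lemma contDiffOn_current (hΩ : IsOpen Ω) (hA : ContDiffOn ℝ ∞ A Ω) (μ : Fin 4) :
    ContDiffOn ℝ ∞ (current A μ) Ω :=
  ContDiffOn.sum fun ν _ => contDiffOn_pd hΩ (contDiffOn_FUp hΩ hA μ ν) ν

lemma contDiffOn_residual (hΩ : IsOpen Ω) (hA : ContDiffOn ℝ ∞ A Ω) {f : Spacetime → ℝ}
    (hf : ContDiffOn ℝ ∞ f Ω) (μ : Fin 4) : ContDiffOn ℝ ∞ (residual A f μ) Ω :=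
  (contDiffOn_current hΩ hA μ).sub (ContDiffOn.sum fun ν _ =>
    (contDiffOn_dualF hΩ hA μ ν).mul (contDiffOn_pd hΩ hf ν))

end Smoothness

section Identities

variable {Ω : Set Spacetime} {A : Spacetime → Fin 4 → ℝ}

lemma _root_.ContDiffOn.differentiableAt_of_isOpen {E G : Type*} [NormedAddCommGroup E]
    [NormedSpace ℝ E] [NormedAddCommGroup G] [NormedSpace ℝ G] {U : Set E} {g : E → G}
    (hg : ContDiffOn ℝ ∞ g U) (hU : IsOpen U) {x : E} (hx : x ∈ U) : DifferentiableAt ℝ g x :=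
  (hg.contDiffAt (hU.mem_nhds hx)).differentiableAt (by simp)

lemma pd_F (hΩ : IsOpen Ω) (hA : ContDiffOn ℝ ∞ A Ω) {x : Spacetime} (hx : x ∈ Ω)
    (α μ ν : Fin 4) : pd α (F A μ ν) x =
      pd α (pd μ fun y => A y ν) x - pd α (pd ν fun y => A y μ) x :=
  pd_sub ((contDiffOn_pd hΩ (contDiffOn_component hA ν) μ).differentiableAt_of_isOpen hΩ hx)
    ((contDiffOn_pd hΩ (contDiffOn_component hA μ) ν).differentiableAt_of_isOpen hΩ hx) α

/-- The homogeneous Maxwell equations `∇_α F_{μν} + ∇_μ F_{να} + ∇_ν F_{αμ} = 0`. -/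
lemma bianchi (hΩ : IsOpen Ω) (hA : ContDiffOn ℝ ∞ A Ω) {x : Spacetime} (hx : x ∈ Ω)
    (α μ ν : Fin 4) :
    pd α (F A μ ν) x + pd μ (F A ν α) x + pd ν (F A α μ) x = 0 := by
  have hc := fun κ : Fin 4 => (contDiffOn_component hA κ).contDiffAt (hΩ.mem_nhds hx)
  rw [pd_F hΩ hA hx, pd_F hΩ hA hx, pd_F hΩ hA hx, pd_comm (hc ν) α μ, pd_comm (hc μ) ν α,
    pd_comm (hc α) μ ν]
  ring

lemma dual_antisymm {T : Fin 4 → Fin 4 → ℝ} (hT : ∀ μ ν, T μ ν = -T ν μ) (μ ν : Fin 4) :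
    dual T μ ν = -dual T ν μ := by
  rw [dual_eq hT, dual_eq hT]
  fin_cases μ <;> fin_cases ν <;> simp

lemma dualF_antisymm (A : Spacetime → Fin 4 → ℝ) (μ ν : Fin 4) (x : Spacetime) :
    dualF A μ ν x = -dualF A ν μ x :=
  dual_antisymm (fun α β => F_antisymm A α β x) μ ν

lemma pd_dualF (hΩ : IsOpen Ω) (hA : ContDiffOn ℝ ∞ A Ω) {x : Spacetime} (hx : x ∈ Ω)
    (κ μ ν : Fin 4) : pd κ (dualF A μ ν) x = dual (fun α β => pd κ (F A α β) x) μ ν := by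
  have hd := fun α β : Fin 4 => (contDiffOn_F hΩ hA α β).differentiableAt_of_isOpen hΩ hx
  change pd κ (fun y => (1 / 2) * ∑ α, ∑ β, epsUp μ ν α β * F A α β y) x =
    (1 / 2) * ∑ α, ∑ β, epsUp μ ν α β * pd κ (F A α β) x
  rw [pd_const_mul (by fun_prop), pd_sum (fun _ _ => by fun_prop)]
  congr 1
  refine Finset.sum_congr rfl fun α _ => ?_
  rw [pd_sum (fun _ _ => by fun_prop)]
  exact Finset.sum_congr rfl fun β _ => pd_const_mul (hd α β) _ _

lemma pd_F_antisymm (A : Spacetime → Fin 4 → ℝ) (κ μ ν : Fin 4) (x : Spacetime) :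
    pd κ (F A μ ν) x = -pd κ (F A ν μ) x := by
  have : F A μ ν = -F A ν μ := funext fun y => F_antisymm A μ ν y
  rw [this, pd, fderiv_neg]
  rfl

/-- The dual field strength is divergence free. -/
lemma sum_pd_dualF (hΩ : IsOpen Ω) (hA : ContDiffOn ℝ ∞ A Ω) {x : Spacetime} (hx : x ∈ Ω)
    (ν : Fin 4) : ∑ μ, pd μ (dualF A μ ν) x = 0 := by
  simp only [pd_dualF hΩ hA hx, dual_eq fun α β => pd_F_antisymm A _ α β x, Fin.sum_univ_four]
  -- Component ν of the divergence is, up to sign, the Bianchi identity on the three other indices.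
  have h1 := bianchi hΩ hA hx 1 2 3
  have h2 := bianchi hΩ hA hx 0 2 3
  have h3 := bianchi hΩ hA hx 0 1 3
  have h4 := bianchi hΩ hA hx 0 1 2
  rw [pd_F_antisymm A _ 3 1] at h1
  rw [pd_F_antisymm A _ 3 0] at h2 h3
  rw [pd_F_antisymm A _ 2 0] at h4
  fin_cases ν <;> simp <;> linarith

lemma pd_FUp (hΩ : IsOpen Ω) (hA : ContDiffOn ℝ ∞ A Ω) {x : Spacetime} (hx : x ∈ Ω)
    (κ μ ν : Fin 4) : pd κ (FUp A μ ν) x = eta μ * eta ν * pd κ (F A μ ν) x :=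
  pd_const_mul ((contDiffOn_F hΩ hA μ ν).differentiableAt_of_isOpen hΩ hx) _ _

/-- The current is conserved. -/
lemma sum_pd_current (hΩ : IsOpen Ω) (hA : ContDiffOn ℝ ∞ A Ω) {x : Spacetime} (hx : x ∈ Ω) :
    ∑ μ, pd μ (current A μ) x = 0 := by
  have hU := fun μ ν : Fin 4 => contDiffOn_FUp hΩ hA μ ν
  have h1 : ∀ μ, pd μ (current A μ) x = ∑ ν, pd μ (pd ν (FUp A μ ν)) x := fun μ =>
    pd_sum (fun ν _ => (contDiffOn_pd hΩ (hU μ ν) ν).differentiableAt_of_isOpen hΩ hx) μ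
  have hanti : ∀ μ ν, FUp A μ ν = -FUp A ν μ := fun μ ν => funext fun y => by
    simp only [FUp, Pi.neg_apply, F_antisymm A μ ν y]; ring
  have h2 : ∀ μ ν, pd μ (pd ν (FUp A μ ν)) x = -pd ν (pd μ (FUp A ν μ)) x := by
    intro μ ν
    have : pd ν (FUp A μ ν) = -pd ν (FUp A ν μ) := funext fun y => by
      rw [hanti μ ν, pd, fderiv_neg]; rfl
    rw [this, ← pd_comm ((hU ν μ).contDiffAt (hΩ.mem_nhds hx)), pd, fderiv_neg]
    rfl
  -- Symmetric second derivatives contracted with the antisymmetric F^{μν}: the sum is its own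
  -- negative.
  have h3 : ∑ μ, pd μ (current A μ) x = -∑ μ, pd μ (current A μ) x := by
    conv_lhs => rw [Finset.sum_congr rfl fun μ _ => h1 μ]
    rw [Finset.sum_comm, ← Finset.sum_neg_distrib]
    refine Finset.sum_congr rfl fun ν _ => ?_
    rw [h1 ν, ← Finset.sum_neg_distrib]
    exact Finset.sum_congr rfl fun μ _ => h2 μ ν
  linarith

/-- The Beltrami equation in terms of its residual. -/
lemma beltramiEquation_iff (hΩ : IsOpen Ω) (hA : ContDiffOn ℝ ∞ A Ω) (f : Spacetime → ℝ) :
    BeltramiEquation Ω A (fun ν => pd ν f) ↔ ∀ x ∈ Ω, ∀ μ, residual A f μ x = 0 := by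
  refine forall₂_congr fun x hx => forall_congr' fun μ => ?_
  have h1 : current A μ x = eta μ * ∑ ν, eta ν * pd ν (F A μ ν) x := by
    rw [current, Finset.mul_sum]
    refine Finset.sum_congr rfl fun ν _ => ?_
    rw [pd_FUp hΩ hA hx]; ring
  have h2 : ∑ ν, dualF A μ ν x * pd ν f x = eta μ *
      ((1 / 2) * ∑ ν, ∑ α, ∑ β, eps μ ν α β * (eta ν * pd ν f x) * FUp A α β x) := by
    simp only [dualF, dual, Finset.mul_sum, Finset.sum_mul]
    refine Finset.sum_congr rfl fun ν _ => Finset.sum_congr rfl fun α _ =>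
      Finset.sum_congr rfl fun β _ => ?_
    simp only [epsUp, FUp]; ring
  have hη : eta μ ≠ 0 := fun h => by simpa [h] using eta_mul_self μ
  rw [residual, h1, h2, ← mul_sub, mul_eq_zero_iff_left hη, sub_eq_zero]

end Identities

end Beltrami

namespace Beltrami

/-! ### Calculus of variations -/

/-- A function that vanishes off a compact set has derivatives of integral zero. -/
lemma setIntegral_pd_eq_zero {Ω K : Set Spacetime} (hΩ : IsOpen Ω) (hK : IsCompact K)
    (hKΩ : K ⊆ Ω) {g : Spacetime → ℝ} (hg : ContDiffOn ℝ ∞ g Ω) (hg0 : ∀ x ∈ Ω \ K, g x = 0)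
    (μ : Fin 4) : ∫ x in K, pd μ g x = 0 := by
  classical
  -- Extension by zero is smooth on all of space: u agrees with g on Ω and vanishes on the open
  -- complement of K. Integration by parts against the constant 1 then applies.
  let u : Spacetime → ℝ := K.indicator g
  have huΩ : ∀ x ∈ Ω, u =ᶠ[𝓝 x] g := by
    intro x hx
    filter_upwards [hΩ.mem_nhds hx] with y hy
    by_cases hyK : y ∈ K
    · exact indicator_of_mem hyK g
    · exact (indicator_of_notMem hyK g).trans (hg0 y ⟨hy, hyK⟩).symm
  have huK : ∀ x ∉ K, u =ᶠ[𝓝 x] fun _ => 0 := by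
    intro x hx
    filter_upwards [hK.isClosed.isOpen_compl.mem_nhds hx] with y hy
    exact indicator_of_notMem hy g
  have hu : ContDiff ℝ ∞ u := by
    rw [contDiff_iff_contDiffAt]
    intro x
    by_cases hx : x ∈ K
    · exact (hg.contDiffAt (hΩ.mem_nhds (hKΩ hx))).congr_of_eventuallyEq (huΩ x (hKΩ hx))
    · exact contDiffAt_const.congr_of_eventuallyEq (huK x hx)
  have hsupp : HasCompactSupport u := HasCompactSupport.intro hK fun x hx =>
    indicator_of_notMem hx g
  have hcont : Continuous fun x => fderiv ℝ u x (Pi.single μ 1) :=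
    (hu.continuous_fderiv (by simp)).clm_apply continuous_const
  have hsupp' : HasCompactSupport fun x => fderiv ℝ u x (Pi.single μ 1) :=
    HasCompactSupport.intro hK fun x hx => by rw [(huK x hx).fderiv_eq]; simp
  have key := integral_mul_fderiv_eq_neg_fderiv_mul_of_integrable (μ := volume)
    (f := fun _ : Spacetime => (1 : ℝ)) (g := u) (v := Pi.single μ 1)
    (by simp) (by simpa using hcont.integrable_of_hasCompactSupport hsupp')
    (by simpa using hu.continuous.integrable_of_hasCompactSupport hsupp)
    (fun x _ => by fun_prop) (fun x _ => (hu.differentiable (by simp)) x)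
  simp only [one_mul, fderiv_fun_const, Pi.zero_apply, zero_apply, zero_mul,
    integral_zero, neg_zero] at key
  rw [← setIntegral_eq_integral_of_forall_compl_eq_zero (s := K)
    (fun x hx => by rw [(huK x hx).fderiv_eq]; simp)] at key
  rw [← key]
  refine setIntegral_congr_fun hK.measurableSet fun x hx => ?_
  simp only [pd, (huΩ x (hKΩ hx)).fderiv_eq]

lemma _root_.ContDiffAt.hasFDerivAt_fderiv_apply {E G : Type*} [NormedAddCommGroup E]
    [NormedSpace ℝ E] [NormedAddCommGroup G] [NormedSpace ℝ G] {g : E → G} {x : E}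
    (hg : ContDiffAt ℝ ∞ g x) (v : E) :
    HasFDerivAt (fun y => fderiv ℝ g y v)
      ((ContinuousLinearMap.apply ℝ G v).comp (fderiv ℝ (fderiv ℝ g) x)) x :=
  (ContinuousLinearMap.apply ℝ G v).hasFDerivAt.comp x hg.differentiableAt_fderiv.hasFDerivAt

/-- Differentiation under the integral sign over a compact set. -/
lemma hasDerivAt_setIntegral {E : Type*} [NormedAddCommGroup E] [NormedSpace ℝ E]
    [MeasurableSpace E] [BorelSpace E] {m : Measure E} [IsFiniteMeasureOnCompacts m]
    {Ω K : Set E} (hΩ : IsOpen Ω) (hK : IsCompact K) (hKΩ : K ⊆ Ω)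
    {G : ℝ × E → ℝ} (hG : ContDiffOn ℝ ∞ G (univ ×ˢ Ω)) :
    HasDerivAt (fun s => ∫ x in K, G (s, x) ∂m) (∫ x in K, fderiv ℝ G (0, x) (1, 0) ∂m) 0 := by
  have hO : IsOpen ((univ : Set ℝ) ×ˢ Ω) := isOpen_univ.prod hΩ
  have hG' : ContDiffOn ℝ ∞ (fun q => fderiv ℝ G q (1, 0)) (univ ×ˢ Ω) :=
    hG.fderiv_clm_apply_of_isOpen hO contDiffOn_const
  have hmaps : ∀ s : ℝ, MapsTo (fun x : E => (s, x)) K (univ ×ˢ Ω) :=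
    fun s x hx => ⟨mem_univ _, hKΩ hx⟩
  have hcs : ∀ s : ℝ, ContinuousOn (fun x => G (s, x)) K := fun s =>
    hG.continuousOn.comp (by fun_prop) (hmaps s)
  have hcs' : ∀ s : ℝ, ContinuousOn (fun x => fderiv ℝ G (s, x) (1, 0)) K := fun s =>
    hG'.continuousOn.comp (f := fun x : E => (s, x)) (by fun_prop) (hmaps s)
  obtain ⟨C, hC⟩ := ((isCompact_Icc (a := (-1 : ℝ)) (b := 1)).prod hK).exists_bound_of_continuousOn
    (hG'.continuousOn.mono fun q hq => ⟨mem_univ _, hKΩ hq.2⟩)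
  have := hasDerivAt_integral_of_dominated_loc_of_deriv_le (μ := m.restrict K) (𝕜 := ℝ)
    (F := fun s x => G (s, x)) (F' := fun s x => fderiv ℝ G (s, x) (1, 0)) (x₀ := 0)
    (s := Icc (-1) 1) (bound := fun _ => C) (Icc_mem_nhds (by norm_num) (by norm_num))
    (Filter.Eventually.of_forall fun s => (hcs s).aestronglyMeasurable_of_isCompact hK
      hK.measurableSet)
    ((hcs 0).integrableOn_compact hK)
    ((hcs' 0).aestronglyMeasurable_of_isCompact hK hK.measurableSet)
    ((ae_restrict_mem hK.measurableSet).mono fun x hx s hs => hC (s, x) ⟨hs, hx⟩)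
    (integrableOn_const hK.measure_lt_top.ne)
    ((ae_restrict_mem hK.measurableSet).mono fun x hx s hs => by
      have h1 := (hG.differentiableAt_of_isOpen hO (hmaps s hx)).hasFDerivAt
      have h2 : HasDerivAt (fun s : ℝ => (s, x)) ((1 : ℝ), (0 : E)) s :=
        (hasDerivAt_id s).prodMk (hasDerivAt_const s x)
      exact h1.comp_hasDerivAt s h2)
  exact this.2

/-- The infinitesimal variation `∂_s A^{(s)}` at `s = 0`. -/
noncomputable def infinitesimal (a : ℝ → Spacetime → Fin 4 → ℝ) (ν : Fin 4) (x : Spacetime) : ℝ :=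
  deriv (fun s => a s x ν) 0

namespace IsVariation

variable {Ω K : Set Spacetime} {A : Spacetime → Fin 4 → ℝ} {a : ℝ → Spacetime → Fin 4 → ℝ}

lemma contDiffOn_component (ha : IsVariation Ω K A a) (ν : Fin 4) :
    ContDiffOn ℝ ∞ (fun q : ℝ × Spacetime => a q.1 q.2 ν) (univ ×ˢ Ω) :=
  contDiffOn_pi.1 ha.smooth ν

lemma pd_eq (ha : IsVariation Ω K A a) (hΩ : IsOpen Ω) {x : Spacetime} (hx : x ∈ Ω) (s : ℝ)
    (μ ν : Fin 4) : pd μ (fun y => a s y ν) x =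
      fderiv ℝ (fun q : ℝ × Spacetime => a q.1 q.2 ν) (s, x) (0, Pi.single μ 1) := by
  have h1 := ((ha.contDiffOn_component ν).differentiableAt_of_isOpen (isOpen_univ.prod hΩ)
    (show (s, x) ∈ (univ : Set ℝ) ×ˢ Ω from ⟨mem_univ _, hx⟩)).hasFDerivAt
  have h2 := h1.comp x (hasFDerivAt_prodMk_right s x)
  rw [pd, show (fun y => a s y ν) = (fun q : ℝ × Spacetime => a q.1 q.2 ν) ∘ fun y => (s, y)
    from rfl, h2.fderiv]
  rfl

lemma infinitesimal_eq (ha : IsVariation Ω K A a) (hΩ : IsOpen Ω) {x : Spacetime} (hx : x ∈ Ω)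
    (ν : Fin 4) : infinitesimal a ν x =
      fderiv ℝ (fun q : ℝ × Spacetime => a q.1 q.2 ν) (0, x) (1, 0) := by
  have h1 := ((ha.contDiffOn_component ν).differentiableAt_of_isOpen (isOpen_univ.prod hΩ)
    (show ((0 : ℝ), x) ∈ (univ : Set ℝ) ×ˢ Ω from ⟨mem_univ _, hx⟩)).hasFDerivAt
  have h2 : HasDerivAt (fun s : ℝ => (s, x)) ((1 : ℝ), (0 : Spacetime)) 0 :=
    (hasDerivAt_id 0).prodMk (hasDerivAt_const 0 x)
  exact (h1.comp_hasDerivAt 0 h2).deriv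

lemma contDiffOn_infinitesimal (ha : IsVariation Ω K A a) (hΩ : IsOpen Ω) (ν : Fin 4) :
    ContDiffOn ℝ ∞ (infinitesimal a ν) Ω := by
  have h := (ha.contDiffOn_component ν).fderiv_clm_apply_of_isOpen (isOpen_univ.prod hΩ)
    (contDiffOn_const (c := ((1 : ℝ), (0 : Spacetime))))
  have h2 : ContDiffOn ℝ ∞ (fun x : Spacetime => ((0 : ℝ), x)) Ω := by fun_prop
  exact (h.comp h2 fun x hx => ⟨mem_univ _, hx⟩).congr fun x hx => ha.infinitesimal_eq hΩ hx ν

lemma infinitesimal_eq_zero (ha : IsVariation Ω K A a) {x : Spacetime} (hx : x ∈ Ω \ K)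
    (ν : Fin 4) : infinitesimal a ν x = 0 := by
  have : (fun s => a s x ν) = fun _ => A x ν := funext fun s => by rw [ha.fixed s x hx]
  rw [infinitesimal, this, deriv_const]

lemma contDiffOn_pd (ha : IsVariation Ω K A a) (hΩ : IsOpen Ω) (μ ν : Fin 4) :
    ContDiffOn ℝ ∞ (fun q : ℝ × Spacetime => pd μ (fun y => a q.1 y ν) q.2) (univ ×ˢ Ω) :=
  ((ha.contDiffOn_component ν).fderiv_clm_apply_of_isOpen (isOpen_univ.prod hΩ)
    (contDiffOn_const (c := ((0 : ℝ), (Pi.single μ 1 : Spacetime))))).congr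
      fun q hq => ha.pd_eq hΩ hq.2 q.1 μ ν

lemma contDiffOn_F (ha : IsVariation Ω K A a) (hΩ : IsOpen Ω) (μ ν : Fin 4) :
    ContDiffOn ℝ ∞ (fun q : ℝ × Spacetime => F (a q.1) μ ν q.2) (univ ×ˢ Ω) :=
  (ha.contDiffOn_pd hΩ μ ν).sub (ha.contDiffOn_pd hΩ ν μ)

/-- ∂_s and ∂_μ commute by symmetry of the second derivative of (s, x) ↦ A^{(s)}_ν(x). -/
lemma hasDerivAt_pd (ha : IsVariation Ω K A a) (hΩ : IsOpen Ω) {x : Spacetime} (hx : x ∈ Ω)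
    (μ ν : Fin 4) :
    HasDerivAt (fun s => pd μ (fun y => a s y ν) x) (pd μ (infinitesimal a ν) x) 0 := by
  set G : ℝ × Spacetime → ℝ := fun q => a q.1 q.2 ν
  have hO : IsOpen ((univ : Set ℝ) ×ˢ Ω) := isOpen_univ.prod hΩ
  have hmem : ((0 : ℝ), x) ∈ (univ : Set ℝ) ×ˢ Ω := ⟨mem_univ _, hx⟩
  have hG : ContDiffAt ℝ ∞ G (0, x) := (ha.contDiffOn_component ν).contDiffAt (hO.mem_nhds hmem)
  have h1 : HasDerivAt (fun s => fderiv ℝ G (s, x) (0, Pi.single μ 1))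
      (fderiv ℝ (fderiv ℝ G) (0, x) (1, 0) (0, Pi.single μ 1)) 0 := by
    have hc : HasDerivAt (fun s : ℝ => (s, x)) ((1 : ℝ), (0 : Spacetime)) 0 :=
      (hasDerivAt_id 0).prodMk (hasDerivAt_const 0 x)
    exact (hG.hasFDerivAt_fderiv_apply (0, Pi.single μ 1)).comp_hasDerivAt 0 hc
  have h2 : pd μ (infinitesimal a ν) x =
      fderiv ℝ (fderiv ℝ G) (0, x) (0, Pi.single μ 1) (1, 0) := by
    have e : infinitesimal a ν =ᶠ[𝓝 x] fun y => fderiv ℝ G (0, y) (1, 0) := by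
      filter_upwards [hΩ.mem_nhds hx] with y hy using ha.infinitesimal_eq hΩ hy ν
    have h3 := (hG.hasFDerivAt_fderiv_apply (1, 0)).comp x
      (hasFDerivAt_prodMk_right (0 : ℝ) x)
    have h4 : HasFDerivAt (fun y => fderiv ℝ G (0, y) (1, 0)) _ x := h3
    rw [pd_congr e, pd, h4.fderiv]
    rfl
  rw [h2, hG.fderiv_symm]
  exact h1.congr_of_eventuallyEq (Filter.Eventually.of_forall fun s => ha.pd_eq hΩ hx s μ ν)

lemma hasDerivAt_F (ha : IsVariation Ω K A a) (hΩ : IsOpen Ω) {x : Spacetime} (hx : x ∈ Ω)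
    (μ ν : Fin 4) :
    HasDerivAt (fun s => F (a s) μ ν x)
      (pd μ (infinitesimal a ν) x - pd ν (infinitesimal a μ) x) 0 :=
  (ha.hasDerivAt_pd hΩ hx μ ν).sub (ha.hasDerivAt_pd hΩ hx ν μ)

lemma F_start (ha : IsVariation Ω K A a) (hΩ : IsOpen Ω) {x : Spacetime} (hx : x ∈ Ω)
    (μ ν : Fin 4) : F (a 0) μ ν x = F A μ ν x := by
  have h : ∀ κ : Fin 4, (fun y => a 0 y κ) =ᶠ[𝓝 x] fun y => A y κ := fun κ => by
    filter_upwards [hΩ.mem_nhds hx] with y hy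
    rw [ha.start y hy]
  rw [F, F, pd_congr (h ν), pd_congr (h μ)]

end IsVariation

end Beltrami

/-! ### First variation of the densities and of the action -/

namespace Beltrami

namespace IsVariation

variable {Ω K : Set Spacetime} {A : Spacetime → Fin 4 → ℝ} {a : ℝ → Spacetime → Fin 4 → ℝ}

/-- The product rule gives ½ F^{μν} δF_{μν}; antisymmetry of F^{μν} merges the two terms of δF. -/
lemma hasDerivAt_maxwellDensity (ha : IsVariation Ω K A a) (hΩ : IsOpen Ω) {x : Spacetime}
    (hx : x ∈ Ω) :
    HasDerivAt (fun s => (1 / 4) * ∑ μ, ∑ ν, F (a s) μ ν x * FUp (a s) μ ν x)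
      (∑ μ, ∑ ν, FUp A μ ν x * pd μ (infinitesimal a ν) x) 0 := by
  have h : HasDerivAt (fun s => (1 / 4) * ∑ μ, ∑ ν, F (a s) μ ν x * FUp (a s) μ ν x) _ 0 :=
    (HasDerivAt.fun_sum fun μ _ => HasDerivAt.fun_sum fun ν _ =>
      (ha.hasDerivAt_F hΩ hx μ ν).mul
        ((ha.hasDerivAt_F hΩ hx μ ν).const_mul (eta μ * eta ν))).const_mul (1 / 4)
  convert h using 1
  simp only [FUp, ha.F_start hΩ hx, Fin.sum_univ_four, F_self, F_antisymm A 1 0,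
    F_antisymm A 2 0, F_antisymm A 3 0, F_antisymm A 2 1, F_antisymm A 3 1, F_antisymm A 3 2]
  ring

/-- The density is -8 times the Pfaffian, so three products suffice. The factor 8 cancels against ½
· ¼ in the action, leaving coefficient f on the dual field. -/
lemma hasDerivAt_epsFF (ha : IsVariation Ω K A a) (hΩ : IsOpen Ω) {x : Spacetime}
    (hx : x ∈ Ω) :
    HasDerivAt (fun s => epsFF (a s) x)
      (8 * ∑ μ, ∑ ν, dualF A μ ν x * pd μ (infinitesimal a ν) x) 0 := by
  simp only [epsFF_eq, pfaffian]
  have hF := fun μ ν => ha.hasDerivAt_F hΩ hx μ ν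
  have h := (((((hF 0 1).mul (hF 2 3)).sub ((hF 0 2).mul (hF 1 3))).add
    ((hF 0 3).mul (hF 1 2)))).const_mul (-8)
  refine h.congr_deriv ?_
  simp only [dualF, dual_eq fun α β => F_antisymm A α β x, ha.F_start hΩ hx, Fin.sum_univ_four]
  simp
  ring

lemma contDiffOn_maxwellDensity (ha : IsVariation Ω K A a) (hΩ : IsOpen Ω) :
    ContDiffOn ℝ ∞ (fun q : ℝ × Spacetime =>
      (1 / 4) * ∑ μ, ∑ ν, F (a q.1) μ ν q.2 * FUp (a q.1) μ ν q.2) (univ ×ˢ Ω) :=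
  contDiffOn_const.mul (ContDiffOn.sum fun μ _ => ContDiffOn.sum fun ν _ =>
    (ha.contDiffOn_F hΩ μ ν).mul (contDiffOn_const.mul (ha.contDiffOn_F hΩ μ ν)))

lemma contDiffOn_helicityDensity (ha : IsVariation Ω K A a) (hΩ : IsOpen Ω) {f : Spacetime → ℝ}
    (hf : ContDiffOn ℝ ∞ f Ω) :
    ContDiffOn ℝ ∞ (fun q : ℝ × Spacetime => (1 / 4) * (f q.2 * epsFF (a q.1) q.2))
      (univ ×ˢ Ω) := by
  have hf' : ContDiffOn ℝ ∞ (fun q : ℝ × Spacetime => f q.2) (univ ×ˢ Ω) :=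
    hf.comp contDiffOn_snd fun q hq => hq.2
  refine contDiffOn_const.mul (hf'.mul ?_)
  exact ContDiffOn.sum fun μ _ => ContDiffOn.sum fun ν _ => ContDiffOn.sum fun α _ =>
    ContDiffOn.sum fun β _ => (contDiffOn_const.mul (ha.contDiffOn_F hΩ μ ν)).mul
      (ha.contDiffOn_F hΩ α β)

end IsVariation

section FirstVariation

variable {Ω K : Set Spacetime} {A : Spacetime → Fin 4 → ℝ} {f : Spacetime → ℝ}

/-- The field momentum `F^{μν} - f · ½ ε^{μναβ} F_{αβ}` of the Lagrangian with multiplier. -/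
noncomputable def momentum (A : Spacetime → Fin 4 → ℝ) (f : Spacetime → ℝ) (μ ν : Fin 4)
    (x : Spacetime) : ℝ :=
  FUp A μ ν x - f x * dualF A μ ν x

lemma contDiffOn_momentum (hΩ : IsOpen Ω) (hA : ContDiffOn ℝ ∞ A Ω) (hf : ContDiffOn ℝ ∞ f Ω)
    (μ ν : Fin 4) : ContDiffOn ℝ ∞ (momentum A f μ ν) Ω :=
  (contDiffOn_FUp hΩ hA μ ν).sub (hf.mul (contDiffOn_dualF hΩ hA μ ν))

lemma FUp_antisymm (A : Spacetime → Fin 4 → ℝ) (μ ν : Fin 4) : FUp A μ ν = -FUp A ν μ :=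
  funext fun x => by simp only [FUp, Pi.neg_apply, F_antisymm A μ ν x]; ring

lemma pd_neg (g : Spacetime → ℝ) (μ : Fin 4) (x : Spacetime) : pd μ (-g) x = -pd μ g x := by
  rw [pd, fderiv_neg]; rfl

/-- Because *F is divergence free, only ∇f survives from the product f *F. The sign comes from
swapping the antisymmetric indices. -/
lemma sum_pd_momentum (hΩ : IsOpen Ω) (hA : ContDiffOn ℝ ∞ A Ω) (hf : ContDiffOn ℝ ∞ f Ω)
    {x : Spacetime} (hx : x ∈ Ω) (ν : Fin 4) :
    ∑ μ, pd μ (momentum A f μ ν) x = -residual A f ν x := by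
  have hf' := hf.differentiableAt_of_isOpen hΩ hx
  have hD := fun μ => (contDiffOn_dualF hΩ hA μ ν).differentiableAt_of_isOpen hΩ hx
  have h : ∀ μ, pd μ (momentum A f μ ν) x = -pd μ (FUp A ν μ) x -
      (-(dualF A ν μ x * pd μ f x) + f x * pd μ (dualF A μ ν) x) := by
    intro μ
    have h1 : pd μ (momentum A f μ ν) x =
        pd μ (FUp A μ ν) x - pd μ (fun y => f y * dualF A μ ν y) x :=
      pd_sub ((contDiffOn_FUp hΩ hA μ ν).differentiableAt_of_isOpen hΩ hx) (hf'.mul (hD μ)) μ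
    rw [h1, pd_mul hf' (hD μ), FUp_antisymm, pd_neg, dualF_antisymm A μ ν x]
    ring
  simp only [h, Finset.sum_sub_distrib, Finset.sum_add_distrib, Finset.sum_neg_distrib,
    ← Finset.mul_sum, sum_pd_dualF hΩ hA hx, residual, current]
  ring

/-- The first variation of the action `W - ½ H̃(f)`. -/
theorem hasDerivAt_action {a : ℝ → Spacetime → Fin 4 → ℝ} (ha : IsVariation Ω K A a)
    (hΩ : IsOpen Ω) (hA : ContDiffOn ℝ ∞ A Ω) (hf : ContDiffOn ℝ ∞ f Ω) (hK : IsCompact K)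
    (hKΩ : K ⊆ Ω) :
    HasDerivAt (fun s => W K (a s) - (1 / 2) * Htilde K f (a s))
      (∫ x in K, ∑ ν, residual A f ν x * infinitesimal a ν x) 0 := by
  have hO : IsOpen ((univ : Set ℝ) ×ˢ Ω) := isOpen_univ.prod hΩ
  let G₁ : ℝ × Spacetime → ℝ := fun q =>
    (1 / 4) * ∑ μ, ∑ ν, F (a q.1) μ ν q.2 * FUp (a q.1) μ ν q.2
  let G₂ : ℝ × Spacetime → ℝ := fun q => (1 / 4) * (f q.2 * epsFF (a q.1) q.2)
  have hG₁ : ContDiffOn ℝ ∞ G₁ (univ ×ˢ Ω) := ha.contDiffOn_maxwellDensity hΩ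
  have hG₂ : ContDiffOn ℝ ∞ G₂ (univ ×ˢ Ω) := ha.contDiffOn_helicityDensity hΩ hf
  have hG : ContDiffOn ℝ ∞ (fun q => G₁ q - (1 / 2) * G₂ q) (univ ×ˢ Ω) :=
    hG₁.sub (contDiffOn_const.mul hG₂)
  have hint : ∀ {G : ℝ × Spacetime → ℝ}, ContDiffOn ℝ ∞ G (univ ×ˢ Ω) → ∀ s : ℝ,
      IntegrableOn (fun x => G (s, x)) K := fun hG s =>
    (hG.continuousOn.comp (f := fun x => (s, x)) (by fun_prop)
      fun x hx => ⟨mem_univ _, hKΩ hx⟩).integrableOn_compact hK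
  have hb := fun ν => ha.contDiffOn_infinitesimal hΩ ν
  have hP := fun μ ν => contDiffOn_momentum hΩ hA hf μ ν
  have haction : (fun s => W K (a s) - (1 / 2) * Htilde K f (a s)) =
      fun s => ∫ x in K, (G₁ (s, x) - (1 / 2) * G₂ (s, x)) := by
    funext s
    rw [integral_sub (hint hG₁ s) ((hint hG₂ s).const_mul _),
      integral_const_mul (1 / 2) fun x => G₂ (s, x)]
    rfl
  have hflux : ContDiffOn ℝ ∞ (fun y => ∑ μ, ∑ ν, pd μ (fun z =>
      momentum A f μ ν z * infinitesimal a ν z) y) Ω :=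
    ContDiffOn.sum fun μ _ => ContDiffOn.sum fun ν _ => contDiffOn_pd hΩ ((hP μ ν).mul (hb ν)) μ
  have hres : ContDiffOn ℝ ∞ (fun y => ∑ ν, residual A f ν y * infinitesimal a ν y) Ω :=
    ContDiffOn.sum fun ν _ => (contDiffOn_residual hΩ hA hf ν).mul (hb ν)
  -- Pointwise integration by parts: π^{μν} ∂_μ b_ν = ∂_μ (π^{μν} b_ν) - (∂_μ π^{μν}) b_ν, with π
  -- the momentum and b the infinitesimal variation.
  have hval : ∀ x ∈ K, fderiv ℝ (fun q => G₁ q - (1 / 2) * G₂ q) (0, x) (1, 0) =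
      (∑ μ, ∑ ν, pd μ (fun z => momentum A f μ ν z * infinitesimal a ν z) x) +
        ∑ ν, residual A f ν x * infinitesimal a ν x := by
    intro x hxK
    have hx := hKΩ hxK
    have hc : HasDerivAt (fun s : ℝ => (s, x)) ((1 : ℝ), (0 : Spacetime)) 0 :=
      (hasDerivAt_id 0).prodMk (hasDerivAt_const 0 x)
    have h1 := (hG.differentiableAt_of_isOpen hO
      (show ((0 : ℝ), x) ∈ (univ : Set ℝ) ×ˢ Ω from ⟨mem_univ _, hx⟩)).hasFDerivAt
    have h2 := h1.comp_hasDerivAt 0 hc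
    have h3 := (ha.hasDerivAt_maxwellDensity hΩ hx).sub
      ((((ha.hasDerivAt_epsFF hΩ hx).const_mul (f x)).const_mul (1 / 4)).const_mul (1 / 2))
    rw [h2.unique h3]
    have h4 : ∀ μ ν, pd μ (fun z => momentum A f μ ν z * infinitesimal a ν z) x =
        pd μ (momentum A f μ ν) x * infinitesimal a ν x +
          momentum A f μ ν x * pd μ (infinitesimal a ν) x := fun μ ν =>
      pd_mul ((hP μ ν).differentiableAt_of_isOpen hΩ hx)
        ((hb ν).differentiableAt_of_isOpen hΩ hx) μ
    simp only [h4, Finset.sum_add_distrib]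
    rw [Finset.sum_comm (f := fun μ ν => pd μ (momentum A f μ ν) x * infinitesimal a ν x)]
    simp only [← Finset.sum_mul, sum_pd_momentum hΩ hA hf hx]
    simp only [momentum, sub_mul, Finset.sum_sub_distrib, neg_mul, Finset.sum_neg_distrib,
      mul_assoc, ← Finset.mul_sum]
    ring
  rw [haction]
  refine (hasDerivAt_setIntegral hΩ hK hKΩ hG).congr_deriv ?_
  rw [setIntegral_congr_fun hK.measurableSet hval, integral_add
    ((hflux.continuousOn.mono hKΩ).integrableOn_compact hK)
    ((hres.continuousOn.mono hKΩ).integrableOn_compact hK)]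
  have hflux0 : ∫ x in K, (∑ μ, ∑ ν, pd μ (fun z =>
      momentum A f μ ν z * infinitesimal a ν z) x) = 0 := by
    have hi : ∀ μ ν, IntegrableOn (fun x => pd μ (fun z =>
        momentum A f μ ν z * infinitesimal a ν z) x) K := fun μ ν =>
      ((contDiffOn_pd hΩ ((hP μ ν).mul (hb ν)) μ).continuousOn.mono hKΩ).integrableOn_compact hK
    rw [integral_finsetSum _ fun μ _ => integrable_finsetSum _ fun ν _ => hi μ ν]
    refine Finset.sum_eq_zero fun μ _ => ?_
    rw [integral_finsetSum _ fun ν _ => hi μ ν]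
    refine Finset.sum_eq_zero fun ν _ => ?_
    exact setIntegral_pd_eq_zero hΩ hK hKΩ ((hP μ ν).mul (hb ν))
      (fun x hx => by rw [ha.infinitesimal_eq_zero hx, mul_zero]) μ
  rw [hflux0, zero_add]

end FirstVariation

end Beltrami

namespace Beltrami

/-! ### Euler-Lagrange equations -/

/-- The fundamental lemma of the calculus of variations on an open set. -/
lemma eqOn_zero_of_setIntegral_mul_eq_zero {Ω : Set Spacetime} (hΩ : IsOpen Ω)
    {R : Spacetime → ℝ} (hR : ContinuousOn R Ω)
    (h : ∀ g : Spacetime → ℝ, ContDiff ℝ ∞ g → HasCompactSupport g → tsupport g ⊆ Ω →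
      ∫ x in tsupport g, g x * R x = 0) : ∀ x ∈ Ω, R x = 0 := by
  have hae : ∀ᵐ x, x ∈ Ω → R x = 0 := by
    refine hΩ.ae_eq_zero_of_integral_contDiff_smul_eq_zero
      (hR.locallyIntegrableOn hΩ.measurableSet) fun g hg hgc hgΩ => ?_
    have h1 := h g hg hgc hgΩ
    rw [setIntegral_eq_integral_of_forall_compl_eq_zero (fun x hx => by
      rw [image_eq_zero_of_notMem_tsupport hx, zero_mul])] at h1
    exact h1
  have hae' : R =ᵐ[volume.restrict Ω] fun _ => 0 :=
    (ae_restrict_iff' hΩ.measurableSet).2 hae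
  exact fun x hx => Measure.eqOn_open_of_ae_eq hae' hΩ hR continuousOn_const hx

section

variable {Ω : Set Spacetime} {A : Spacetime → Fin 4 → ℝ} {f : Spacetime → ℝ}

lemma isMultiplierExtremal_of_residual_eq_zero (hΩ : IsOpen Ω) (hA : ContDiffOn ℝ ∞ A Ω)
    (hf : ContDiffOn ℝ ∞ f Ω) (h : ∀ x ∈ Ω, ∀ μ, residual A f μ x = 0) :
    IsMultiplierExtremal Ω f A := by
  intro K hKΩ hK a ha
  refine (hasDerivAt_action ha hΩ hA hf hK hKΩ).congr_deriv ?_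
  rw [setIntegral_congr_fun (g := fun _ => 0) hK.measurableSet fun x hx => by
    simp [h x (hKΩ hx)], integral_zero]

lemma residual_eq_zero_of_isMultiplierExtremal (hΩ : IsOpen Ω) (hA : ContDiffOn ℝ ∞ A Ω)
    (hf : ContDiffOn ℝ ∞ f Ω) (h : IsMultiplierExtremal Ω f A) (ν : Fin 4) :
    ∀ x ∈ Ω, residual A f ν x = 0 := by
  refine eqOn_zero_of_setIntegral_mul_eq_zero hΩ (contDiffOn_residual hΩ hA hf ν).continuousOn
    fun g hg hgc hgΩ => ?_
  -- An affine variation in the single component ν isolates the residual with index ν.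
  let a : ℝ → Spacetime → Fin 4 → ℝ := fun s x => A x + (s * g x) • Pi.single ν 1
  have ha : IsVariation Ω (tsupport g) A a := by
    refine ⟨?_, fun x _ => by simp [a], fun s x hx => ?_⟩
    · have h1 : ContDiffOn ℝ ∞ (fun q : ℝ × Spacetime => A q.2) (univ ×ˢ Ω) :=
        hA.comp contDiffOn_snd fun q hq => hq.2
      exact h1.add (ContDiff.contDiffOn (by fun_prop))
    · simp [a, image_eq_zero_of_notMem_tsupport hx.2]
  have hinf : ∀ μ x, infinitesimal a μ x = g x * (Pi.single ν 1 : Fin 4 → ℝ) μ := by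
    intro μ x
    have : HasDerivAt (fun s => A x μ + s * g x * (Pi.single ν 1 : Fin 4 → ℝ) μ)
        (1 * g x * (Pi.single ν 1 : Fin 4 → ℝ) μ) 0 :=
      (((hasDerivAt_id (0 : ℝ)).mul_const _).mul_const _).const_add _
    rw [one_mul] at this
    exact this.deriv
  have h1 := (hasDerivAt_action ha hΩ hA hf hgc hgΩ).unique (h _ hgΩ hgc a ha)
  rw [← h1]
  refine setIntegral_congr_fun (isClosed_tsupport g).measurableSet fun x _ => ?_
  simp only [hinf]
  rw [Finset.sum_eq_single ν (fun μ _ hμ => by simp [hμ]) (by simp)]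
  simp [mul_comm]

end

/-! ### Variations by deformations of the domain -/

/-- The deformation `x ↦ x + t χ(x) e_κ` of spacetime. -/
noncomputable def deform (κ : Fin 4) (χ : Spacetime → ℝ) (t : ℝ) (x : Spacetime) : Spacetime :=
  x + (t * χ x) • Pi.single κ 1

/-- The pullback of the potential `A` along `deform κ χ t`. -/
noncomputable def pullback (κ : Fin 4) (χ : Spacetime → ℝ) (A : Spacetime → Fin 4 → ℝ) (t : ℝ)
    (x : Spacetime) (μ : Fin 4) : ℝ :=
  A (deform κ χ t x) μ + t * pd μ χ x * A (deform κ χ t x) κ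

section

variable {κ : Fin 4} {χ : Spacetime → ℝ} {A : Spacetime → Fin 4 → ℝ}

lemma contDiff_pd (hχ : ContDiff ℝ ∞ χ) (μ : Fin 4) : ContDiff ℝ ∞ (pd μ χ) :=
  contDiffOn_univ.1 (contDiffOn_pd isOpen_univ hχ.contDiffOn μ)

lemma pd_comp_deform (hχ : ContDiff ℝ ∞ χ) {g : Spacetime → ℝ} {t : ℝ} {x : Spacetime}
    (hg : DifferentiableAt ℝ g (deform κ χ t x)) (μ : Fin 4) :
    pd μ (fun y => g (deform κ χ t y)) x =
      pd μ g (deform κ χ t x) + t * pd μ χ x * pd κ g (deform κ χ t x) := by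
  have h1 : HasFDerivAt (deform κ χ t) (ContinuousLinearMap.id ℝ Spacetime +
      (t • fderiv ℝ χ x).smulRight (Pi.single κ 1)) x :=
    (hasFDerivAt_id x).add
      ((((hχ.differentiable (by simp)) x).hasFDerivAt.const_mul t).smul_const (Pi.single κ 1))
  have h2 : HasFDerivAt (fun y => g (deform κ χ t y)) _ x := hg.hasFDerivAt.comp x h1
  rw [pd, h2.fderiv]
  simp [pd]

/-- Exterior derivative commutes with pullback: the terms in ∂_μ∂_ν χ and in t² are symmetric in μ,
ν and cancel. -/
lemma F_pullback (hχ : ContDiff ℝ ∞ χ) {t : ℝ} {x : Spacetime}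
    (hA : ∀ μ, DifferentiableAt ℝ (fun y => A y μ) (deform κ χ t x)) (μ ν : Fin 4) :
    F (pullback κ χ A t) μ ν x = F A μ ν (deform κ χ t x) +
      t * pd μ χ x * F A κ ν (deform κ χ t x) + t * pd ν χ x * F A μ κ (deform κ χ t x) := by
  have hψ : DifferentiableAt ℝ (deform κ χ t) x :=
    differentiableAt_id.add ((((hχ.differentiable (by simp)) x).const_mul t).smul_const _)
  have hc : ∀ μ, DifferentiableAt ℝ (fun y => A (deform κ χ t y) μ) x := fun μ =>
    (hA μ).comp x hψ
  have hp : ∀ μ, DifferentiableAt ℝ (fun y => t * pd μ χ y) x := fun μ =>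
    (((contDiff_pd hχ μ).differentiable (by simp)) x).const_mul t
  have h : ∀ μ ν, pd μ (fun y => pullback κ χ A t y ν) x =
      pd μ (fun y => A y ν) (deform κ χ t x) +
      t * pd μ χ x * pd κ (fun y => A y ν) (deform κ χ t x) +
      (t * pd μ (pd ν χ) x * A (deform κ χ t x) κ + t * pd ν χ x *
        (pd μ (fun y => A y κ) (deform κ χ t x) +
          t * pd μ χ x * pd κ (fun y => A y κ) (deform κ χ t x))) := by
    intro μ ν
    simp only [pullback]
    rw [pd_add (hc ν) ((hp ν).fun_mul (hc κ)), pd_mul (hp ν) (hc κ),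
      pd_const_mul (((contDiff_pd hχ ν).differentiable (by simp)) x),
      pd_comp_deform hχ (hA ν), pd_comp_deform hχ (hA κ)]
  rw [F, h, h, pd_comm hχ.contDiffAt ν μ]
  simp only [F]
  ring

/-- F ∧ F is a 4-form, so it pulls back with the Jacobian determinant, here 1 + t ∂_κ χ. The
constraint is therefore preserved whether or not the deformation is invertible. -/
lemma epsFF_pullback (hχ : ContDiff ℝ ∞ χ) {t : ℝ} {x : Spacetime}
    (hA : ∀ μ, DifferentiableAt ℝ (fun y => A y μ) (deform κ χ t x)) :
    epsFF (pullback κ χ A t) x = (1 + t * pd κ χ x) * epsFF A (deform κ χ t x) := by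
  simp only [epsFF_eq, pfaffian, F_pullback hχ hA]
  have h := F_antisymm A
  fin_cases κ <;>
    simp [h 1 0, h 2 0, h 2 1, h 3 1, h 3 2] <;> ring

/-- Small deformations supported in `Ω` map `Ω` to itself. -/
lemma exists_deform_mem {Ω : Set Spacetime} (hΩ : IsOpen Ω) (hχ : Continuous χ)
    (hχc : HasCompactSupport χ) (hχΩ : tsupport χ ⊆ Ω) :
    ∃ c > 0, ∀ t, |t| ≤ c → ∀ x ∈ Ω, deform κ χ t x ∈ Ω := by
  obtain ⟨δ, hδ, hthick⟩ := IsCompact.exists_thickening_subset_open hχc hΩ hχΩ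
  obtain ⟨M, hM⟩ := hχ.bounded_above_of_compact_support hχc
  have hM1 : 0 < |M| + 1 := by positivity
  -- Displacements are then at most δ / 2 on the support of χ and zero off it; the added 1 keeps the
  -- denominator positive.
  refine ⟨δ / (2 * (|M| + 1)), by positivity, fun t ht x hx => ?_⟩
  by_cases hxs : x ∈ tsupport χ
  · refine hthick (Metric.mem_thickening_iff.2 ⟨x, hxs, ?_⟩)
    rw [dist_eq_norm, deform, add_sub_cancel_left, norm_smul, Real.norm_eq_abs, abs_mul,
      Pi.norm_single, norm_one, mul_one]
    have hx1 : |χ x| ≤ |M| + 1 := by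
      have := hM x
      rw [Real.norm_eq_abs] at this
      linarith [le_abs_self M]
    calc |t| * |χ x| ≤ δ / (2 * (|M| + 1)) * (|M| + 1) := by gcongr
      _ = δ / 2 := by field_simp
      _ < δ := by linarith
  · simpa [deform, image_eq_zero_of_notMem_tsupport hxs] using hx

lemma pd_eq_zero_of_notMem_tsupport {x : Spacetime} (hx : x ∉ tsupport χ) (μ : Fin 4) :
    pd μ χ x = 0 := by
  have : χ =ᶠ[𝓝 x] fun _ => 0 := notMem_tsupport_iff_eventuallyEq.1 hx
  rw [pd_congr this]
  simp [pd]

/-- The bounded reparametrization keeps the deformed potentials defined for all parameters. -/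
lemma isVariation_pullback {Ω : Set Spacetime} (hA : ContDiffOn ℝ ∞ A Ω)
    (hχ : ContDiff ℝ ∞ χ) {c : ℝ} (hc : 0 < c)
    (hmem : ∀ t, |t| ≤ c → ∀ x ∈ Ω, deform κ χ t x ∈ Ω) :
    IsVariation Ω (tsupport χ) A fun s => pullback κ χ A (c * Real.sin s) := by
  refine ⟨?_, fun x _ => ?_, fun s x hx => ?_⟩
  · rw [contDiffOn_pi]
    intro μ
    have hψ : ContDiff ℝ ∞ fun q : ℝ × Spacetime => deform κ χ (c * Real.sin q.1) q.2 := by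
      unfold deform
      fun_prop
    have hmaps : MapsTo (fun q : ℝ × Spacetime => deform κ χ (c * Real.sin q.1) q.2)
        (univ ×ˢ Ω) Ω := fun q hq => hmem _ (by
      rw [abs_mul, abs_of_pos hc]
      exact mul_le_of_le_one_right hc.le (Real.abs_sin_le_one _)) q.2 hq.2
    have hcomp : ∀ ν, ContDiffOn ℝ ∞ (fun q : ℝ × Spacetime =>
        A (deform κ χ (c * Real.sin q.1) q.2) ν) (univ ×ˢ Ω) := fun ν =>
      (contDiffOn_component hA ν).comp hψ.contDiffOn hmaps
    have hpd := contDiff_pd hχ μ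
    exact (hcomp μ).add ((ContDiff.contDiffOn (by fun_prop)).mul (hcomp κ))
  · funext μ
    simp [pullback, deform]
  · funext μ
    simp [pullback, deform, image_eq_zero_of_notMem_tsupport hx.2,
      pd_eq_zero_of_notMem_tsupport hx.2]

/-- Cartan's formula for the Lie derivative of A along χ e_κ; the factor c is the derivative of c
sin s at 0. -/
lemma infinitesimal_pullback {x : Spacetime} (hA : ∀ μ, DifferentiableAt ℝ (fun y => A y μ) x)
    (hχ : DifferentiableAt ℝ χ x) (c : ℝ) (μ : Fin 4) :
    infinitesimal (fun s => pullback κ χ A (c * Real.sin s)) μ x =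
      c * (χ x * F A κ μ x + pd μ (fun y => χ y * A y κ) x) := by
  have hτ : HasDerivAt (fun s => c * Real.sin s) c 0 := by
    simpa using (Real.hasDerivAt_sin 0).const_mul c
  have hψ : HasDerivAt (fun s => deform κ χ (c * Real.sin s) x)
      ((c * χ x) • (Pi.single κ 1 : Spacetime)) 0 :=
    ((hτ.mul_const (χ x)).smul_const _).const_add x
  have hψ0 : deform κ χ (c * Real.sin 0) x = x := by simp [deform]
  have hcomp : ∀ ν, HasDerivAt (fun s => A (deform κ χ (c * Real.sin s) x) ν)
      (c * χ x * pd κ (fun y => A y ν) x) 0 := by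
    intro ν
    have h1 : HasFDerivAt (fun y => A y ν) (fderiv ℝ (fun y => A y ν) x)
        (deform κ χ (c * Real.sin 0) x) := by
      rw [hψ0]; exact (hA ν).hasFDerivAt
    have h2 := h1.comp_hasDerivAt 0 hψ
    rw [map_smul] at h2
    exact h2
  have h : HasDerivAt (fun s => pullback κ χ A (c * Real.sin s) x μ) _ 0 :=
    (hcomp μ).add ((hτ.mul_const (pd μ χ x)).mul (hcomp κ))
  rw [infinitesimal, h.deriv, pd_mul hχ (hA κ), F, hψ0]
  simp
  ring

end

/-- For a constrained extremal the current is annihilated by the field strength. -/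
theorem IsConstrainedExtremal.sum_current_mul_F {Ω : Set Spacetime} {A : Spacetime → Fin 4 → ℝ}
    (hΩ : IsOpen Ω) (hA : ContDiffOn ℝ ∞ A Ω) (h : IsConstrainedExtremal Ω A) (κ : Fin 4) :
    ∀ x ∈ Ω, ∑ μ, F A κ μ x * current A μ x = 0 := by
  have hJ := fun μ => contDiffOn_current hΩ hA μ
  refine eqOn_zero_of_setIntegral_mul_eq_zero hΩ (ContDiffOn.continuousOn (n := ∞)
    (ContDiffOn.sum fun μ _ => (contDiffOn_F hΩ hA κ μ).mul (hJ μ))) fun χ hχ hχc hχΩ => ?_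
  obtain ⟨c, hc, hmem⟩ := exists_deform_mem (κ := κ) hΩ hχ.continuous hχc hχΩ
  have ha := isVariation_pullback (κ := κ) hA hχ hc hmem
  have hdA := fun {x} (hx : x ∈ Ω) μ => (contDiffOn_component hA μ).differentiableAt_of_isOpen hΩ hx
  have hconstr : ∀ s, ∀ x ∈ Ω, epsFF (pullback κ χ A (c * Real.sin s)) x = 0 := by
    intro s x hx
    have hm : deform κ χ (c * Real.sin s) x ∈ Ω := hmem _ (by
      rw [abs_mul, abs_of_pos hc]
      exact mul_le_of_le_one_right hc.le (Real.abs_sin_le_one _)) x hx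
    rw [epsFF_pullback hχ (hdA hm), h.constraint _ hm, mul_zero]
  have h1 := h.stationary _ hχΩ hχc _ ha hconstr
  -- The zero multiplier turns the general formula into the first variation of W alone.
  have h2 := hasDerivAt_action ha hΩ hA (contDiffOn_const (c := (0 : ℝ))) hχc hχΩ
  have h3 : (fun s => W (tsupport χ) (pullback κ χ A (c * Real.sin s)) -
      (1 / 2) * Htilde (tsupport χ) (fun _ => 0) (pullback κ χ A (c * Real.sin s))) =
      fun s => W (tsupport χ) (pullback κ χ A (c * Real.sin s)) := by
    funext s; simp [Htilde]
  rw [h3] at h2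
  have h4 := h2.unique h1
  have hχA : ContDiffOn ℝ ∞ (fun y => χ y * A y κ) Ω :=
    hχ.contDiffOn.mul (contDiffOn_component hA κ)
  -- Conservation of the current makes the gauge part J^μ ∂_μ (χ A_κ) a divergence, which integrates
  -- to zero.
  have hval : ∀ x ∈ tsupport χ, ∑ μ, residual A (fun _ => 0) μ x *
      infinitesimal (fun s => pullback κ χ A (c * Real.sin s)) μ x =
      c * (χ x * ∑ μ, F A κ μ x * current A μ x) +
        c * ∑ μ, pd μ (fun y => current A μ y * (χ y * A y κ)) x := by
    intro x hx
    have hxΩ := hχΩ hx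
    have hdχ := (hχ.differentiable (by simp)) x
    have e1 : ∀ μ, residual A (fun _ => 0) μ x = current A μ x := fun μ => by
      simp [residual, pd]
    have e2 : ∀ μ, pd μ (fun y => current A μ y * (χ y * A y κ)) x =
        pd μ (current A μ) x * (χ x * A x κ) +
          current A μ x * pd μ (fun y => χ y * A y κ) x := fun μ =>
      pd_mul ((hJ μ).differentiableAt_of_isOpen hΩ hxΩ) (hχA.differentiableAt_of_isOpen hΩ hxΩ) μ
    simp only [e1, e2, infinitesimal_pullback (hdA hxΩ) hdχ, Finset.sum_add_distrib,
      ← Finset.sum_mul, sum_pd_current hΩ hA hxΩ, zero_mul, zero_add, Finset.mul_sum]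
    rw [← Finset.sum_add_distrib]
    exact Finset.sum_congr rfl fun μ _ => by ring
  have hi : ∀ μ, IntegrableOn (pd μ fun y => current A μ y * (χ y * A y κ)) (tsupport χ) :=
    fun μ => ((contDiffOn_pd hΩ ((hJ μ).mul hχA) μ).continuousOn.mono hχΩ).integrableOn_compact hχc
  have hi' : IntegrableOn (fun x => χ x * ∑ μ, F A κ μ x * current A μ x) (tsupport χ) :=
    ((ContDiffOn.continuousOn (n := ∞) (hχ.contDiffOn.mul
      (ContDiffOn.sum fun μ _ => (contDiffOn_F hΩ hA κ μ).mul (hJ μ)))).mono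
        hχΩ).integrableOn_compact hχc
  rw [setIntegral_congr_fun (isClosed_tsupport χ).measurableSet hval,
    integral_add (hi'.const_mul c) ((integrable_finsetSum _ fun μ _ => hi μ).const_mul c),
    integral_const_mul, integral_const_mul, integral_finsetSum _ fun μ _ => hi μ,
    Finset.sum_eq_zero fun μ _ => setIntegral_pd_eq_zero hΩ hχc hχΩ ((hJ μ).mul hχA)
      (fun x hx => by simp [image_eq_zero_of_notMem_tsupport hx.2]) μ, mul_zero, add_zero] at h4
  exact (mul_eq_zero.1 h4).resolve_left hc.ne'

end Beltrami

namespace Beltrami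

/-! ### Existence of the multiplier -/

lemma sum_dual_mul_vec {T : Fin 4 → Fin 4 → ℝ} (hT : ∀ μ ν, T μ ν = -T ν μ) (v : Fin 4 → ℝ)
    (μ : Fin 4) :
    ∑ ν, dual T μ ν * v ν = (![-T 2 3 * v 1 + T 1 3 * v 2 - T 1 2 * v 3,
      T 2 3 * v 0 - T 0 3 * v 2 + T 0 2 * v 3, -T 1 3 * v 0 + T 0 3 * v 1 - T 0 1 * v 3,
      T 1 2 * v 0 - T 0 2 * v 1 + T 0 1 * v 2] : Fin 4 → ℝ) μ := by
  simp only [dual_eq hT, Fin.sum_univ_four]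
  fin_cases μ <;> simp <;> ring

/-- The indices `c`, `d` complement `a`, `b`, and `s` is the sign `ε^{cdab}`. -/
structure IsComplement (a b c d : Fin 4) (s : ℝ) : Prop where
  sign_ne : s ≠ 0
  ne : a ≠ b ∧ c ≠ a ∧ c ≠ b ∧ d ≠ a ∧ d ≠ b ∧ d ≠ c
  sum_eq : ∀ g : Fin 4 → ℝ, g 0 + g 1 + g 2 + g 3 = g a + g b + g c + g d
  sum_dual : ∀ T : Fin 4 → Fin 4 → ℝ, (∀ μ ν, T μ ν = -T ν μ) → ∀ v : Fin 4 → ℝ,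
    ∑ ν, dual T c ν * v ν = s * (T a b * v d - T d b * v a + T d a * v b) ∧
    ∑ ν, dual T d ν * v ν = -s * (T a b * v c - T c b * v a + T c a * v b)

lemma exists_isComplement {a b : Fin 4} (hab : a < b) : ∃ c d s, IsComplement a b c d s := by
  have cases : (a = 0 ∧ b = 1) ∨ (a = 0 ∧ b = 2) ∨ (a = 0 ∧ b = 3) ∨ (a = 1 ∧ b = 2) ∨
      (a = 1 ∧ b = 3) ∨ (a = 2 ∧ b = 3) := by
    revert a b; decide
  rcases cases with ⟨rfl, rfl⟩ | ⟨rfl, rfl⟩ | ⟨rfl, rfl⟩ | ⟨rfl, rfl⟩ | ⟨rfl, rfl⟩ | ⟨rfl, rfl⟩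
  · refine ⟨2, 3, -1, by norm_num, by decide, fun g => by ring, fun T hT v => ?_⟩
    rw [sum_dual_mul_vec hT, sum_dual_mul_vec hT, hT 3 1, hT 3 0, hT 2 1, hT 2 0]
    constructor <;> simp <;> ring
  · refine ⟨1, 3, 1, by norm_num, by decide, fun g => by ring, fun T hT v => ?_⟩
    rw [sum_dual_mul_vec hT, sum_dual_mul_vec hT, hT 3 2, hT 3 0, hT 1 0]
    constructor <;> simp <;> ring
  · refine ⟨1, 2, -1, by norm_num, by decide, fun g => by ring, fun T hT v => ?_⟩
    rw [sum_dual_mul_vec hT, sum_dual_mul_vec hT, hT 2 0, hT 1 0]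
    constructor <;> simp <;> ring
  · refine ⟨0, 3, -1, by norm_num, by decide, fun g => by ring, fun T hT v => ?_⟩
    rw [sum_dual_mul_vec hT, sum_dual_mul_vec hT, hT 3 2, hT 3 1]
    constructor
    all_goals simp
    all_goals ring
  · refine ⟨0, 2, 1, by norm_num, by decide, fun g => by ring, fun T hT v => ?_⟩
    rw [sum_dual_mul_vec hT, sum_dual_mul_vec hT, hT 2 1]
    constructor <;> simp <;> ring
  · refine ⟨0, 1, -1, by norm_num, by decide, fun g => by ring, fun T hT v => ?_⟩
    rw [sum_dual_mul_vec hT, sum_dual_mul_vec hT]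
    constructor
    all_goals simp
    all_goals ring

lemma IsComplement.sum_univ {a b c d : Fin 4} {s : ℝ} (h : IsComplement a b c d s)
    (g : Fin 4 → ℝ) : ∑ μ, g μ = g a + g b + g c + g d := by
  rw [Fin.sum_univ_four, h.sum_eq]

/-- The Pfaffian relation in terms of an index pair and its complement. -/
lemma IsComplement.mul_eq_of_pfaffian_eq_zero {a b c d : Fin 4} {s : ℝ}
    (h : IsComplement a b c d s) {T : Fin 4 → Fin 4 → ℝ} (hT : ∀ μ ν, T μ ν = -T ν μ)
    (hpf : pfaffian T = 0) : T a b * T c d = T c a * T d b - T d a * T c b := by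
  -- Take v to be row c of T in `sum_dual`: the left side is minus a diagonal entry of T *T, hence
  -- minus the Pfaffian.
  have h1 := sum_mul_dual hT c c
  have h2 := (h.sum_dual T hT (T c)).1
  have h3 : ∑ ν, dual T c ν * T c ν = 0 := by
    rw [if_pos rfl, hpf] at h1
    rw [← neg_eq_zero, ← Finset.sum_neg_distrib, ← h1]
    refine Finset.sum_congr rfl fun ν _ => ?_
    rw [dual_antisymm hT ν c]; ring
  rw [h3] at h2
  have h4 := (mul_eq_zero.1 h2.symm).resolve_left h.sign_ne
  linarith

/-! ### Kernel fields, their commutation and the compatibility condition -/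

/-- The vector field `e_e - (F_{eb} / F_{ab}) e_a + (F_{ea} / F_{ab}) e_b`, which spans together
with its companion the kernel of a degenerate field strength with `F_{ab} ≠ 0`. -/
noncomputable def kernelField (A : Spacetime → Fin 4 → ℝ) (a b e : Fin 4) (x : Spacetime) :
    Spacetime :=
  Pi.single e 1 - (F A e b x / F A a b x) • Pi.single a 1 + (F A e a x / F A a b x) • Pi.single b 1

lemma fderiv_kernelField (A : Spacetime → Fin 4 → ℝ) (a b e : Fin 4) (g : Spacetime → ℝ)
    (x : Spacetime) : fderiv ℝ g x (kernelField A a b e x) =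
      pd e g x - F A e b x / F A a b x * pd a g x + F A e a x / F A a b x * pd b g x := by
  simp only [kernelField, map_add, map_sub, map_smul, smul_eq_mul, pd]

lemma pd_div {g h : Spacetime → ℝ} {x : Spacetime} (hg : DifferentiableAt ℝ g x)
    (hh : DifferentiableAt ℝ h x) (h0 : h x ≠ 0) (μ : Fin 4) :
    pd μ (fun y => g y / h y) x = (pd μ g x * h x - g x * pd μ h x) / h x ^ 2 := by
  have hq : DifferentiableAt ℝ (fun y => g y / h y) x := by
    simpa only [div_eq_mul_inv] using hg.fun_mul (hh.fun_inv h0)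
  have e : g =ᶠ[𝓝 x] fun y => g y / h y * h y := by
    filter_upwards [hh.continuousAt.eventually_ne h0] with y hy
    rw [div_mul_cancel₀ _ hy]
  have h1 := pd_congr e μ
  rw [pd_mul hq hh] at h1
  rw [h1]
  field_simp
  ring

/-- Over the common denominator F_{ab}³, the commutation and compatibility identities reduce to
polynomial identities between numerators. -/
lemma fderiv_kernelField_div {A : Spacetime → Fin 4 → ℝ} {a b e : Fin 4} {g : Spacetime → ℝ}
    {x : Spacetime} (hg : DifferentiableAt ℝ g x) (hF : DifferentiableAt ℝ (F A a b) x)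
    (h0 : F A a b x ≠ 0) :
    fderiv ℝ (fun y => g y / F A a b y) x (kernelField A a b e x) =
      (F A a b x * (pd e g x * F A a b x - g x * pd e (F A a b) x) -
        F A e b x * (pd a g x * F A a b x - g x * pd a (F A a b) x) +
        F A e a x * (pd b g x * F A a b x - g x * pd b (F A a b) x)) / F A a b x ^ 3 := by
  rw [fderiv_kernelField, pd_div hg hF h0, pd_div hg hF h0, pd_div hg hF h0]
  field_simp

section

variable {Ω : Set Spacetime} {A : Spacetime → Fin 4 → ℝ} {a b c d : Fin 4} {s : ℝ}

lemma contDiffOn_kernelField (hΩ : IsOpen Ω) (hA : ContDiffOn ℝ ∞ A Ω)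
    (h0 : ∀ x ∈ Ω, F A a b x ≠ 0) (e : Fin 4) : ContDiffOn ℝ ∞ (kernelField A a b e) Ω := by
  have hF := fun μ ν => contDiffOn_F hΩ hA μ ν
  exact (contDiffOn_const.sub (((hF e b).div (hF a b) h0).smul contDiffOn_const)).add
    (((hF e a).div (hF a b) h0).smul contDiffOn_const)

lemma fderiv_kernelField_apply (hΩ : IsOpen Ω) (hA : ContDiffOn ℝ ∞ A Ω)
    (h0 : ∀ x ∈ Ω, F A a b x ≠ 0) (e : Fin 4) {x : Spacetime} (hx : x ∈ Ω) (v : Spacetime) :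
    fderiv ℝ (kernelField A a b e) x v =
      -(fderiv ℝ (fun y => F A e b y / F A a b y) x v) • (Pi.single a 1 : Spacetime) +
        fderiv ℝ (fun y => F A e a y / F A a b y) x v • (Pi.single b 1 : Spacetime) := by
  have hd := fun μ => (((contDiffOn_F hΩ hA e μ).div (contDiffOn_F hΩ hA a b)
    h0).differentiableAt_of_isOpen hΩ hx).hasFDerivAt
  have h : HasFDerivAt (kernelField A a b e) _ x :=
    (((hd b).smul_const (Pi.single a 1 : Spacetime)).const_sub (Pi.single e 1)).add
      ((hd a).smul_const (Pi.single b 1 : Spacetime))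
  rw [h.fderiv]
  simp
  rfl

lemma IsComplement.pfaffian_relation (hc : IsComplement a b c d s)
    (hpf : ∀ x ∈ Ω, epsFF A x = 0) {x : Spacetime} (hx : x ∈ Ω) :
    F A a b x * F A c d x = F A c a x * F A d b x - F A d a x * F A c b x := by
  refine hc.mul_eq_of_pfaffian_eq_zero (fun μ ν => F_antisymm A μ ν x) ?_
  have := epsFF_eq A x
  rw [hpf x hx] at this
  linarith

/-- Degeneracy holds on an open set, so it can be differentiated; this removes the derivatives of
F_{cd} that Bianchi brings into the commutator. -/
lemma IsComplement.pd_pfaffian_relation (hc : IsComplement a b c d s) (hΩ : IsOpen Ω)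
    (hA : ContDiffOn ℝ ∞ A Ω) (hpf : ∀ x ∈ Ω, epsFF A x = 0) {x : Spacetime} (hx : x ∈ Ω)
    (μ : Fin 4) :
    pd μ (F A a b) x * F A c d x + F A a b x * pd μ (F A c d) x =
      (pd μ (F A c a) x * F A d b x + F A c a x * pd μ (F A d b) x) -
        (pd μ (F A d a) x * F A c b x + F A d a x * pd μ (F A c b) x) := by
  have hd := fun α β => (contDiffOn_F hΩ hA α β).differentiableAt_of_isOpen hΩ hx
  have e : (fun y => F A a b y * F A c d y) =ᶠ[𝓝 x]
      fun y => F A c a y * F A d b y - F A d a y * F A c b y := by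
    filter_upwards [hΩ.mem_nhds hx] with y hy using hc.pfaffian_relation hpf hy
  have h := pd_congr e μ
  rwa [pd_sub ((hd _ _).fun_mul (hd _ _)) ((hd _ _).fun_mul (hd _ _)), pd_mul (hd _ _) (hd _ _),
    pd_mul (hd _ _) (hd _ _), pd_mul (hd _ _) (hd _ _)] at h

/-- The kernel fields of a degenerate closed two-form commute. -/
lemma IsComplement.fderiv_kernelField_comm (hc : IsComplement a b c d s) (hΩ : IsOpen Ω)
    (hA : ContDiffOn ℝ ∞ A Ω) (hpf : ∀ x ∈ Ω, epsFF A x = 0) (h0 : ∀ x ∈ Ω, F A a b x ≠ 0)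
    {x : Spacetime} (hx : x ∈ Ω) :
    fderiv ℝ (kernelField A a b d) x (kernelField A a b c x) =
      fderiv ℝ (kernelField A a b c) x (kernelField A a b d x) := by
  have hd := fun α β => (contDiffOn_F hΩ hA α β).differentiableAt_of_isOpen hΩ hx
  have hB := bianchi hΩ hA hx
  have an := pd_F_antisymm A
  have p := hc.pfaffian_relation hpf hx
  have dp := hc.pd_pfaffian_relation hΩ hA hpf hx
  have B1 := hB c d b
  have B2 := hB c d a
  have Bc := hB a b c
  have Bd := hB a b d
  rw [an d b c] at B1
  rw [an d a c] at B2
  rw [an a b c] at Bc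
  rw [an a b d] at Bd
  rw [fderiv_kernelField_apply hΩ hA h0 d hx, fderiv_kernelField_apply hΩ hA h0 c hx]
  -- The e_c and e_d coefficients are constant, so only the e_a and e_b coefficients of the bracket
  -- need checking.
  have hb : fderiv ℝ (fun y => F A d b y / F A a b y) x (kernelField A a b c x) =
      fderiv ℝ (fun y => F A c b y / F A a b y) x (kernelField A a b d x) := by
    rw [fderiv_kernelField_div (hd _ _) (hd _ _) (h0 x hx),
      fderiv_kernelField_div (hd _ _) (hd _ _) (h0 x hx)]
    congr 1
    linear_combination F A a b x ^ 2 * B1 - F A a b x * dp b + pd b (F A a b) x * p -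
      F A a b x * F A d b x * Bc + F A a b x * F A c b x * Bd
  have ha : fderiv ℝ (fun y => F A d a y / F A a b y) x (kernelField A a b c x) =
      fderiv ℝ (fun y => F A c a y / F A a b y) x (kernelField A a b d x) := by
    rw [fderiv_kernelField_div (hd _ _) (hd _ _) (h0 x hx),
      fderiv_kernelField_div (hd _ _) (hd _ _) (h0 x hx)]
    congr 1
    linear_combination F A a b x ^ 2 * B2 - F A a b x * dp a + pd a (F A a b) x * p -
      F A a b x * F A d a x * Bc + F A a b x * F A c a x * Bd
  rw [hb, ha]

/-- The compatibility condition for the multiplier, from conservation of the current. -/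
lemma IsComplement.fderiv_current_compat (hc : IsComplement a b c d s) (hΩ : IsOpen Ω)
    (hA : ContDiffOn ℝ ∞ A Ω) (hJ : ∀ κ, ∀ x ∈ Ω, ∑ μ, F A κ μ x * current A μ x = 0)
    (h0 : ∀ x ∈ Ω, F A a b x ≠ 0) {x : Spacetime} (hx : x ∈ Ω) :
    fderiv ℝ (fun y => current A c y / F A a b y) x (kernelField A a b c x) =
      -fderiv ℝ (fun y => current A d y / F A a b y) x (kernelField A a b d x) := by
  have hd := fun α β => (contDiffOn_F hΩ hA α β).differentiableAt_of_isOpen hΩ hx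
  have hdJ := fun α => (contDiffOn_current hΩ hA α).differentiableAt_of_isOpen hΩ hx
  have hB := bianchi hΩ hA hx
  have an := pd_F_antisymm A
  have Bc := hB a b c
  have Bd := hB a b d
  rw [an a b c] at Bc
  rw [an a b d] at Bd
  have hdiv := sum_pd_current hΩ hA hx
  rw [hc.sum_univ] at hdiv
  -- Rows b and a of F J = 0 express J^a and J^b through J^c and J^d; differentiating them
  -- eliminates ∂_a J^a and ∂_b J^b from the divergence.
  have ra : ∀ y ∈ Ω, F A a b y * current A a y =
      -(F A c b y * current A c y + F A d b y * current A d y) := by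
    intro y hy
    have := hJ b y hy
    rw [hc.sum_univ, F_self, F_antisymm A b a, F_antisymm A b c, F_antisymm A b d] at this
    linarith
  have rb : ∀ y ∈ Ω, F A a b y * current A b y =
      F A c a y * current A c y + F A d a y * current A d y := by
    intro y hy
    have := hJ a y hy
    rw [hc.sum_univ, F_self, F_antisymm A a c, F_antisymm A a d] at this
    linarith
  have dra : pd a (F A a b) x * current A a x + F A a b x * pd a (current A a) x =
      -((pd a (F A c b) x * current A c x + F A c b x * pd a (current A c) x) +
        (pd a (F A d b) x * current A d x + F A d b x * pd a (current A d) x)) := by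
    have e : (fun y => F A a b y * current A a y) =ᶠ[𝓝 x]
        -fun y => F A c b y * current A c y + F A d b y * current A d y := by
      filter_upwards [hΩ.mem_nhds hx] with y hy using ra y hy
    have h := pd_congr e a
    rwa [pd_neg, pd_add ((hd _ _).fun_mul (hdJ _)) ((hd _ _).fun_mul (hdJ _)),
      pd_mul (hd _ _) (hdJ _), pd_mul (hd _ _) (hdJ _), pd_mul (hd _ _) (hdJ _)] at h
  have drb : pd b (F A a b) x * current A b x + F A a b x * pd b (current A b) x =
      (pd b (F A c a) x * current A c x + F A c a x * pd b (current A c) x) +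
        (pd b (F A d a) x * current A d x + F A d a x * pd b (current A d) x) := by
    have e : (fun y => F A a b y * current A b y) =ᶠ[𝓝 x]
        fun y => F A c a y * current A c y + F A d a y * current A d y := by
      filter_upwards [hΩ.mem_nhds hx] with y hy using rb y hy
    have h := pd_congr e b
    rwa [pd_add ((hd _ _).fun_mul (hdJ _)) ((hd _ _).fun_mul (hdJ _)),
      pd_mul (hd _ _) (hdJ _), pd_mul (hd _ _) (hdJ _), pd_mul (hd _ _) (hdJ _)] at h
  rw [fderiv_kernelField_div (hdJ _) (hd _ _) (h0 x hx),
    fderiv_kernelField_div (hdJ _) (hd _ _) (h0 x hx), ← neg_div]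
  congr 1
  have ra' := ra x hx
  have rb' := rb x hx
  linear_combination F A a b x ^ 2 * hdiv - F A a b x * dra + pd a (F A a b) x * ra' -
    F A a b x * drb + pd b (F A a b) x * rb' - F A a b x * current A c x * Bc -
    F A a b x * current A d x * Bd

/-- Local existence of the multiplier where the field strength does not vanish. -/
theorem exists_residual_eq_zero (hΩ : IsOpen Ω) (hA : ContDiffOn ℝ ∞ A Ω)
    (hpf : ∀ x ∈ Ω, epsFF A x = 0) (hJ : ∀ κ, ∀ x ∈ Ω, ∑ μ, F A κ μ x * current A μ x = 0)
    {p : Spacetime} (hp : p ∈ Ω) (hF : ∃ μ ν, F A μ ν p ≠ 0) :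
    ∃ U ⊆ Ω, IsOpen U ∧ p ∈ U ∧ ∃ f : Spacetime → ℝ, ContDiffOn ℝ ∞ f U ∧
      ∀ x ∈ U, ∀ μ, residual A f μ x = 0 := by
  obtain ⟨a, b, hab, hFp⟩ : ∃ a b, a < b ∧ F A a b p ≠ 0 := by
    obtain ⟨μ, ν, h⟩ := hF
    rcases lt_trichotomy μ ν with hlt | heq | hgt
    · exact ⟨μ, ν, hlt, h⟩
    · subst heq; exact absurd (F_self A μ p) h
    · exact ⟨ν, μ, hgt, fun h' => h (by rw [F_antisymm, h', neg_zero])⟩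
  obtain ⟨c, d, s, hc⟩ := exists_isComplement hab
  obtain ⟨-, hca, hcb, hda, hdb, hdc⟩ := hc.ne
  set Ω' : Set Spacetime := Ω ∩ F A a b ⁻¹' {0}ᶜ with hΩ'_def
  have hΩ' : IsOpen Ω' :=
    (contDiffOn_F hΩ hA a b).continuousOn.isOpen_inter_preimage hΩ isOpen_compl_singleton
  have hsub : Ω' ⊆ Ω := inter_subset_left
  have hA' := hA.mono hsub
  have h0 : ∀ x ∈ Ω', F A a b x ≠ 0 := fun x hx => hx.2
  have hpf' : ∀ x ∈ Ω', epsFF A x = 0 := fun x hx => hpf x (hsub hx)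
  have hJ' : ∀ κ, ∀ x ∈ Ω', ∑ μ, F A κ μ x * current A μ x = 0 := fun κ x hx => hJ κ x (hsub hx)
  have hk : ∀ e, ContDiffOn ℝ ∞ (fun y => current A e y / F A a b y) Ω' := fun e =>
    (contDiffOn_current hΩ' hA' e).div (contDiffOn_F hΩ' hA' a b) h0
  obtain ⟨U, hUΩ', hU, hpU, f, hf, hXf⟩ := exists_smooth_fderiv_eq_of_commute
    (ContinuousLinearMap.proj (R := ℝ) (φ := fun _ : Fin 4 => ℝ) c)
    (ContinuousLinearMap.proj (R := ℝ) (φ := fun _ : Fin 4 => ℝ) d) hΩ'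
    (show p ∈ Ω' from ⟨hp, hFp⟩) (contDiffOn_kernelField hΩ' hA' h0 c)
    (contDiffOn_kernelField hΩ' hA' h0 d)
    (fun x _ => by simp [kernelField, hca, hcb])
    (fun x _ => by simp [kernelField, hda, hdb])
    (fun x _ => by simp [kernelField, hda, hdb, hdc])
    (fun x hx => hc.fderiv_kernelField_comm hΩ' hA' hpf' h0 hx)
    -- Read off from components d and c of *F ∇f = J: component d contains only the derivative along
    -- X_c, and component c only that along X_d.
    (k₁ := fun x => -s⁻¹ * (current A d x / F A a b x))
    (k₂ := fun x => s⁻¹ * (current A c x / F A a b x))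
    (contDiffOn_const.mul (hk d)) (contDiffOn_const.mul (hk c)) (fun x hx => by
      have hd : ∀ e, DifferentiableAt ℝ (fun y => current A e y / F A a b y) x := fun e =>
        (hk e).differentiableAt_of_isOpen hΩ' hx
      rw [fderiv_const_mul (hd c), fderiv_const_mul (hd d)]
      simp only [smul_apply, smul_eq_mul]
      rw [hc.fderiv_current_compat hΩ' hA' hJ' h0 hx]
      ring)
  refine ⟨U, hUΩ'.trans hsub, hU, hpU, f, hf, fun x hx => ?_⟩
  have hx' := hUΩ' hx
  have hg := h0 x hx'
  have hs := hc.sign_ne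
  have hT := fun μ ν => F_antisymm A μ ν x
  obtain ⟨hXc, hXd⟩ := hXf x hx
  rw [fderiv_kernelField] at hXc hXd
  field_simp at hXc hXd
  obtain ⟨hDc, hDd⟩ := hc.sum_dual (fun μ ν => F A μ ν x) hT fun ν => pd ν f x
  have hRc : residual A f c x = 0 := by
    simp only [residual, dualF, hDc]
    linear_combination -hXd
  have hRd : residual A f d x = 0 := by
    simp only [residual, dualF, hDd]
    linear_combination hXc
  have hpfx : pfaffian (fun μ ν => F A μ ν x) = 0 := by
    have := epsFF_eq A x
    rw [hpf' x hx'] at this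
    linarith
  -- F kills J, and F *F is the Pfaffian times the identity, hence 0. With R^c = R^d = 0, rows b and
  -- a then leave only F_{ab} R^a and F_{ab} R^b.
  have hR : ∀ κ, ∑ μ, F A κ μ x * residual A f μ x = 0 := by
    intro κ
    simp only [residual, mul_sub, Finset.sum_sub_distrib, hJ' κ x hx', Finset.mul_sum]
    rw [Finset.sum_comm]
    simp only [← mul_assoc, ← Finset.sum_mul, dualF, sum_mul_dual hT, hpfx]
    simp
  have hRa : residual A f a x = 0 := by
    have := hR b
    rw [hc.sum_univ, hRc, hRd, F_self, F_antisymm A b a] at this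
    simpa [hg] using this
  have hRb : residual A f b x = 0 := by
    have := hR a
    rw [hc.sum_univ, hRc, hRd, F_self] at this
    simpa [hg] using this
  intro μ
  have hμ : μ = a ∨ μ = b ∨ μ = c ∨ μ = d := by
    by_contra! hne
    -- An index outside {a, b, c, d} would give the unit vector at μ coordinate sum 0 instead of 1.
    have := hc.sum_univ (Pi.single μ 1)
    simp [hne.1.symm, hne.2.1.symm, hne.2.2.1.symm, hne.2.2.2.symm] at this
  rcases hμ with rfl | rfl | rfl | rfl <;> assumption

end

end Beltrami

theorem theorem1 (Ω : Set Beltrami.Spacetime) (hΩ : IsOpen Ω)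
    (A : Beltrami.Spacetime → Fin 4 → ℝ) (hA : ContDiffOn ℝ ∞ A Ω) :
    (Beltrami.IsConstrainedExtremal Ω A →
      ∀ x ∈ Ω,
        ((∃ μ ν, Beltrami.F A μ ν x ≠ 0) ∨ ∀ᶠ y in 𝓝 x, ∀ μ ν, Beltrami.F A μ ν y = 0) →
        ∃ U ⊆ Ω, IsOpen U ∧ x ∈ U ∧ ∃ f : Beltrami.Spacetime → ℝ, ContDiffOn ℝ ∞ f U ∧
          Beltrami.IsMultiplierExtremal U f A ∧
          Beltrami.BeltramiEquation U A (fun ν => Beltrami.pd ν f)) ∧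
    (∀ f : Beltrami.Spacetime → ℝ, ContDiffOn ℝ ∞ f Ω →
      (∀ x ∈ Ω, Beltrami.epsFF A x = 0) →
      Beltrami.IsMultiplierExtremal Ω f A →
      Beltrami.BeltramiEquation Ω A (fun ν => Beltrami.pd ν f)) := by
  open Beltrami in
  refine ⟨fun h x hx hcases => ?_, fun f hf _ hext => ?_⟩
  · obtain ⟨U, hUΩ, hU, hxU, f, hf, hR⟩ : ∃ U ⊆ Ω, IsOpen U ∧ x ∈ U ∧ ∃ f : Spacetime → ℝ,
        ContDiffOn ℝ ∞ f U ∧ ∀ y ∈ U, ∀ μ, Beltrami.residual A f μ y = 0 := by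
      rcases hcases with hF | hF
      · exact exists_residual_eq_zero hΩ hA h.constraint
          (fun κ => h.sum_current_mul_F hΩ hA κ) hx hF
      · obtain ⟨V, hV, hVo, hxV⟩ := eventually_nhds_iff.1 hF
        refine ⟨Ω ∩ V, inter_subset_left, hΩ.inter hVo, ⟨hx, hxV⟩, fun _ => 0, contDiffOn_const,
          fun y hy μ => ?_⟩
        have e : ∀ ν, pd ν (FUp A μ ν) y = 0 := fun ν => by
          have : FUp A μ ν =ᶠ[𝓝 y] fun _ => 0 := by
            filter_upwards [hVo.mem_nhds hy.2] with z hz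
            rw [FUp, hV z hz, mul_zero]
          rw [pd_congr this]
          simp [pd]
        have e' : ∀ ν, pd ν (fun _ => (0 : ℝ)) y = 0 := fun ν => by simp [pd]
        simp [Beltrami.residual, current, e, e']
    have hAU := hA.mono hUΩ
    exact ⟨U, hUΩ, hU, hxU, f, hf, isMultiplierExtremal_of_residual_eq_zero hU hAU hf hR,
      (beltramiEquation_iff hU hAU f).2 hR⟩
  · exact (beltramiEquation_iff hΩ hA f).2 fun x hx μ =>
      residual_eq_zero_of_isMultiplierExtremal hΩ hA hf hext μ x hx
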